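/- \textbf{Local adiabatic theorem under a block-antidiagonal perturbation.} Let $\mathcal H$ be a finite-dimensional complex Hilbert space, $S\subseteq\mathcal H$ a subspace, $\overline S:=S^\perp$, and let $P_Q$ denote the orthogonal projection onto a subspace $Q$. Let $H(s)$, $s\in[0,1]$, be a twice differentiable family of Hermitian operators with $[H(s),P_S]=0$, let $\Delta(s)$, $s\in[0,1]$, be a differentiable family of Hermitian operators with $\Delta P_S=P_{\overline S}\Delta$, and let $T>0$. Dots denote derivatives in $s$ (one-sided at the end points) and $\|\cdot\|$ is the operator norm. For $Q\in\{S,\overline S\}$ put $H_Q:=P_QHP_Q$. Let $\mu<\mu_1$ be the two smallest distinct eigenvalues of $H_S|_S$ and $\overline\mu<\overline\mu_1$ those of $H_{\overline S}|_{\overline S}$; they are assumed to exist for every $s$. Put $\Gamma_S:=\mu_1-\mu$, $\Gamma_{\overline S}:=\overline\mu_1-\overline\mu$ and $\Gamma:=\min\{\Gamma_S,\Gamma_{\overline S}\}$. Let $P_\mu$ and $P_{\overline\mu}$ be the orthogonal projections onto $\{x\in S: H_Sx=\mu x\}$ and $\{x\in\overline S: H_{\overline S}x=\overline\mu x\}$;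 the dimensions of these two spaces are assumed not to depend on $s$ (for instance, both ground energies are simple). Put \[ \Delta^\perp:=(I-P_\mu-P_{\overline\mu})\,\Delta\,(I-P_\mu-P_{\overline\mu}),\qquad H':=H+(\mu-\overline\mu)P_{\overline S},\qquad \eta:=1-\frac{\|\Delta^\perp\|}{\Gamma}, \] and assume $\eta(s)>0$ for all $s\in[0,1]$. Let $U'_\perp$ and $V_{\mathrm{ad}}$ solve, on $[0,1]$, \[ i\dot U'_\perp=T(H'+\Delta^\perp)U'_\perp,\qquad i\dot V_{\mathrm{ad}}=\bigl(TH+i[\dot P_\mu,P_\mu]\bigr)V_{\mathrm{ad}},\qquad U'_\perp(0)=V_{\mathrm{ad}}(0)=I . \] Define $C:=C_1+C_2$, where \[ C_1:=2\frac{\|\dot H_S\|}{\Gamma_S^2}, \] \[ C_2:=\frac{\|\ddot H_S\|}{\Gamma_S^2}+10\frac{\|\dot H_S^2\|}{\Gamma_S^3} +\frac1\eta\frac{\|\dot H_S\|}{\Gamma_S^2}\left(\frac{\|\dot\Delta^\perp\|}{\Gamma}+4\|\Delta^\perp\|\max\left\{\frac{\|\dot H_S\|}{\Gamma_S^2},\frac{2\|\dot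 H_{\overline S}\|+\|\dot H_S\|}{\Gamma_{\overline S}^2}\right\}\right) \] and $\dot\Delta^\perp$ is the derivative of $\Delta^\perp$. Then \[ \bigl\|(U'_\perp(1)-V_{\mathrm{ad}}(1))P_\mu(0)\bigr\|\;\le\;\sup_{s\in[0,1]}\frac{C_1(s)}{\eta(s)\,T}\;+\;\sup_{s\in[0,1]}\frac{C_2(s)}{\eta(s)\,T}, \] that is, the bound $C/(\eta T)$ with the maximization over $s$ carried out separately for the two parts of $C$. (The suprema are taken in $[0,\infty]$.) -/

import Mathlib

open Set

namespace LocalAdiabatic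

noncomputable section

section Static

variable {E : Type*} [NormedAddCommGroup E] [InnerProductSpace ℂ E] [FiniteDimensional ℂ E]

/-- The block `A_S = P_S A P_S` of an operator `A`. -/
def block (S : Submodule ℂ E) (A : E →L[ℂ] E) : E →L[ℂ] E :=
  S.starProjection * A * S.starProjection

/-- The (real) eigenvalues of the block `A_S` regarded as an operator on `S`. -/
def localSpectrum (S : Submodule ℂ E) (A : E →L[ℂ] E) : Set ℝ :=
  {x | ∃ v ∈ S, v ≠ 0 ∧ block S A v = (x : ℂ) • v}

/-- The smallest eigenvalue of `A_S` on `S`. -/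
def groundEnergy (S : Submodule ℂ E) (A : E →L[ℂ] E) : ℝ :=
  sInf (localSpectrum S A)

/-- The second smallest (distinct) eigenvalue of `A_S` on `S`. -/
def firstExcitedEnergy (S : Submodule ℂ E) (A : E →L[ℂ] E) : ℝ :=
  sInf (localSpectrum S A \ {groundEnergy S A})

/-- The local gap `Γ_S`. -/
def localGap (S : Submodule ℂ E) (A : E →L[ℂ] E) : ℝ :=
  firstExcitedEnergy S A - groundEnergy S A

/-- The local ground space: the vectors `v` of `S` with `A_S v = μ v`. -/
def groundSpace (S : Submodule ℂ E) (A : E →L[ℂ] E) : Submodule ℂ E :=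
  S ⊓ LinearMap.ker (block S A - ((groundEnergy S A : ℝ) : ℂ) • (1 : E →L[ℂ] E)).toLinearMap

/-- The orthogonal projection `P_μ` onto the local ground space. -/
def groundProj (S : Submodule ℂ E) (A : E →L[ℂ] E) : E →L[ℂ] E :=
  (groundSpace S A).starProjection

/-- `Δ^⊥ = (I - P_μ - P_μ̄) Δ (I - P_μ - P_μ̄)`, where `A` is the block-diagonal Hamiltonian. -/
def perpPart (S : Submodule ℂ E) (A D : E →L[ℂ] E) : E →L[ℂ] E :=
  (1 - groundProj S A - groundProj Sᗮ A) * D * (1 - groundProj S A - groundProj Sᗮ A)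

/-- The shifted Hamiltonian `H' = H + (μ - μ̄) P_S̄`, whose two local ground energies agree. -/
def shifted (S : Submodule ℂ E) (A : E →L[ℂ] E) : E →L[ℂ] E :=
  A + ((groundEnergy S A - groundEnergy Sᗮ A : ℝ) : ℂ) • Sᗮ.starProjection

/-- The smaller of the two local gaps. -/
def minGap (S : Submodule ℂ E) (A : E →L[ℂ] E) : ℝ :=
  min (localGap S A) (localGap Sᗮ A)

/-- `η = 1 - ‖Δ^⊥‖ / min {Γ_S, Γ_S̄}`. -/
def eta (S : Submodule ℂ E) (A D : E →L[ℂ] E) : ℝ :=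
  1 - ‖perpPart S A D‖ / minGap S A

end Static

/-- The derivative in the rescaled time `s ∈ [0,1]`, one-sided at the end points. -/
def dot {F : Type*} [NormedAddCommGroup F] [NormedSpace ℝ F] (f : ℝ → F) (s : ℝ) : F :=
  derivWithin f (Icc 0 1) s

section Dynamic

variable {E : Type*} [NormedAddCommGroup E] [InnerProductSpace ℂ E] [FiniteDimensional ℂ E]

/-- `U` solves `i U̇(s) = G(s) U(s)` on `[0,1]` with `U(0) = I`. -/
def IsEvolution (G U : ℝ → E →L[ℂ] E) : Prop :=
  U 0 = 1 ∧ ∀ s ∈ Icc (0 : ℝ) 1, ∃ U' : E →L[ℂ] E,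
    HasDerivWithinAt U U' (Icc 0 1) s ∧ Complex.I • U' = G s * U s

/-- The generator `T (H'(s) + Δ^⊥(s))`. -/
def perturbedGenerator (S : Submodule ℂ E) (H Δ : ℝ → E →L[ℂ] E) (T : ℝ) (s : ℝ) : E →L[ℂ] E :=
  (T : ℂ) • (shifted S (H s) + perpPart S (H s) (Δ s))

/-- The adiabatic generator `T H(s) + i [Ṗ_μ(s), P_μ(s)]`. -/
def adiabaticGenerator (S : Submodule ℂ E) (H : ℝ → E →L[ℂ] E) (T : ℝ) (s : ℝ) : E →L[ℂ] E :=
  (T : ℂ) • H s + Complex.I •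
    (dot (fun t => groundProj S (H t)) s * groundProj S (H s)
      - groundProj S (H s) * dot (fun t => groundProj S (H t)) s)

/-- `‖Ḣ_S(s)‖`. -/
def normDot (S : Submodule ℂ E) (H : ℝ → E →L[ℂ] E) (s : ℝ) : ℝ :=
  ‖dot (fun t => block S (H t)) s‖

/-- `2 ‖Ḣ_S‖ / Γ_S²`: the summand of `C` that comes from the end points of the evolution. -/
def boundaryConst (S : Submodule ℂ E) (H : ℝ → E →L[ℂ] E) (s : ℝ) : ℝ :=
  2 * (normDot S H s / localGap S (H s) ^ 2)

/-- The remaining summands of `C`. -/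
def bulkConst (S : Submodule ℂ E) (H Δ : ℝ → E →L[ℂ] E) (s : ℝ) : ℝ :=
  ‖dot (dot (fun t => block S (H t))) s‖ / localGap S (H s) ^ 2
    + 10 * (‖dot (fun t => block S (H t)) s ^ 2‖ / localGap S (H s) ^ 3)
    + 1 / eta S (H s) (Δ s) * (normDot S H s / localGap S (H s) ^ 2)
      * (‖dot (fun t => perpPart S (H t) (Δ t)) s‖ / minGap S (H s)
          + 4 * ‖perpPart S (H s) (Δ s)‖
            * max (normDot S H s / localGap S (H s) ^ 2)
                ((2 * normDot Sᗮ H s + normDot S H s) / localGap Sᗮ (H s) ^ 2))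

end Dynamic

end

end LocalAdiabatic

/-! Kato's adiabatic argument, with one integration by parts adapted to the perturbation. Write `P`
and `P̄` for the ground projections of the two blocks, `r` for the reduced resolvent of `H_S - μ`,
`R` for the sum of the reduced resolvents of the two blocks, and `X = V P(0)`. The commutator in the
adiabatic generator makes `V` carry the range of `P(0)` to that of `P(s)`
(`adiabatic_intertwining`), so `P X = X`. On the range of `P` both generators act as `T μ`, since
the shift in `H'` does not touch `S` and `Δ^⊥ P = 0`, except for the term `i Ṗ P` of the adiabatic
one. Hence `U* X` has derivative `U* Ṗ X`, which is not small by itself.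

It is removed by finding `Y = Y P` with `(H' - μ + Δ^⊥) Y = Ṗ P`. Then `U* X - (iT)⁻¹ U* Y X` has
derivative `-(iT)⁻¹ U* Ẏ X` (`hasDerivWithinAt_comparison`). The mean value inequality bounds its
increment by the supremum of `‖Ẏ P‖ / T`, and the values of the added term at the two end points
cost `‖Y‖ / T` each. These two contributions never mix, which is why the suprema are separate.

Without perturbation the solution is `y = -r² Ḣ_S P`, because `Ṗ P = -r Ḣ_S P`. In general `Y` is
defined by `(1 + R Δ^⊥) Y = y`: the shift makes the two ground energies agree, so `(H' - μ) R = 1 -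
P - P̄`, a projection that leaves `Δ^⊥` unchanged. Since `‖R‖ ≤ 1/Γ`, one has `‖R Δ^⊥‖ ≤ 1 - η`, and
each inversion of `1 + R Δ^⊥` costs a factor `1/η` (`norm_correction_le`,
`norm_dot_correction_mul_le`).

All this needs `μ`, `P` and `r` to be differentiable in `s`. That is derived from the gap and the
constant multiplicity, pointwise in `s`, by exact difference identities. -/

namespace LocalAdiabatic

/-! ### Variational description of the local ground energy and gap -/

section Static

variable {E : Type*} [NormedAddCommGroup E] [InnerProductSpace ℂ E] [FiniteDimensional ℂ E]

/-- On a nonzero invariant subspace of a symmetric operator the quadratic form is bounded below by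
an eigenvalue which is attained in the subspace. -/
theorem exists_least_eigenvalue_of_invariant {B : E →ₗ[ℂ] E} (hB : B.IsSymmetric)
    {K : Submodule ℂ E} (hK : K ≠ ⊥) (hinv : ∀ v ∈ K, B v ∈ K) :
    ∃ ν : ℝ, (∃ v ∈ K, v ≠ 0 ∧ B v = (ν : ℂ) • v) ∧
      ∀ w ∈ K, ν * ‖w‖ ^ 2 ≤ (inner ℂ (B w) w).re := by
  have : Nontrivial K := Submodule.nontrivial_iff_ne_bot.mpr hK
  have hsym : (B.restrict hinv).IsSymmetric := hB.restrict_invariant hinv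
  refine ⟨⨅ x : {x : K // x ≠ 0},
    RCLike.re (inner ℂ (B.restrict hinv (x : K)) (x : K)) / ‖(x : K)‖ ^ 2, ?_, ?_⟩
  · obtain ⟨v, hv⟩ := hsym.hasEigenvalue_iInf_of_finiteDimensional.exists_hasEigenvector
    refine ⟨v, v.2, by simpa using hv.2, ?_⟩
    have := congrArg (Subtype.val) hv.apply_eq_smul
    simpa using this
  · intro w hw
    by_cases h0 : w = 0
    · simp [h0]
    have hpos : 0 < ‖w‖ ^ 2 := by positivity
    rw [← le_div_iff₀ hpos]
    have hbdd : BddBelow (Set.range fun x : {x : K // x ≠ 0} =>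
        RCLike.re (inner ℂ (B.restrict hinv (x : K)) (x : K)) / ‖(x : K)‖ ^ 2) := by
      refine ⟨-‖(B.restrict hinv).toContinuousLinearMap‖, ?_⟩
      rintro _ ⟨x, rfl⟩
      exact (abs_le.mp
        ((B.restrict hinv).toContinuousLinearMap.rayleighQuotient_le_norm (x : K))).1
    exact ciInf_le hbdd ⟨⟨w, hw⟩, by simpa using h0⟩

theorem block_isSelfAdjoint (S : Submodule ℂ E) {A : E →L[ℂ] E} (hA : IsSelfAdjoint A) :
    IsSelfAdjoint (block S A) := by
  have := hA.conjugate_self (isSelfAdjoint_starProjection S)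
  simpa [block] using this

theorem block_isSymmetric (S : Submodule ℂ E) {A : E →L[ℂ] E} (hA : IsSelfAdjoint A) :
    ((block S A : E →L[ℂ] E) : E →ₗ[ℂ] E).IsSymmetric :=
  (ContinuousLinearMap.isSelfAdjoint_iff_isSymmetric).mp (block_isSelfAdjoint S hA)

theorem block_apply_mem (S : Submodule ℂ E) (A : E →L[ℂ] E) (v : E) : block S A v ∈ S := by
  simp [block]

theorem mem_groundSpace {S : Submodule ℂ E} {A : E →L[ℂ] E} {v : E} :
    v ∈ groundSpace S A ↔ v ∈ S ∧ block S A v = ((groundEnergy S A : ℝ) : ℂ) • v := by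
  simp [groundSpace, sub_eq_zero]

theorem groundSpace_le (S : Submodule ℂ E) (A : E →L[ℂ] E) : groundSpace S A ≤ S := inf_le_left

theorem isLeast_of_eigenvalue_le {S K : Submodule ℂ E} {A : E →L[ℂ] E} {ν : ℝ} {X : Set ℝ}
    (hν : ν ∈ X) (hX : ∀ x ∈ X, ∃ v ∈ K, v ≠ 0 ∧ block S A v = (x : ℂ) • v)
    (hle : ∀ w ∈ K, ν * ‖w‖ ^ 2 ≤ (inner ℂ (block S A w) w).re) : IsLeast X ν := by
  refine ⟨hν, fun x hx => ?_⟩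
  obtain ⟨v, hv, hv0, hBv⟩ := hX x hx
  have h := hle v hv
  rw [hBv, inner_smul_left, inner_self_eq_norm_sq_to_K] at h
  have hre : ((starRingEnd ℂ) (x : ℂ) * ((‖v‖ : ℝ) : ℂ) ^ 2).re = x * ‖v‖ ^ 2 := by
    rw [Complex.conj_ofReal]
    norm_cast
  have hpos : 0 < ‖v‖ ^ 2 := by positivity
  exact le_of_mul_le_mul_right (h.trans_eq hre) hpos

theorem isLeast_groundEnergy {S : Submodule ℂ E} {A : E →L[ℂ] E} (hA : IsSelfAdjoint A)
    (hne : (localSpectrum S A).Nonempty) :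
    IsLeast (localSpectrum S A) (groundEnergy S A) ∧
      ∀ w ∈ S, groundEnergy S A * ‖w‖ ^ 2 ≤ (inner ℂ (block S A w) w).re := by
  have hS : S ≠ ⊥ := by
    rintro rfl
    obtain ⟨x, v, hv, hv0, -⟩ := hne
    exact hv0 (by simpa using hv)
  obtain ⟨ν, hν, hle⟩ := exists_least_eigenvalue_of_invariant (block_isSymmetric S hA) hS
    (fun v _ => block_apply_mem S A v)
  have hleast : IsLeast (localSpectrum S A) ν :=
    isLeast_of_eigenvalue_le hν (fun x hx => hx) hle
  have : groundEnergy S A = ν := hleast.csInf_eq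
  rw [this]
  exact ⟨hleast, hle⟩

theorem inner_eigenvector_eq_zero {F : Type*} [NormedAddCommGroup F] [InnerProductSpace ℂ F]
    {B : F →ₗ[ℂ] F} (hB : B.IsSymmetric) {x y : ℝ} (hxy : x ≠ y) {v w : F}
    (hv : B v = (x : ℂ) • v) (hw : B w = (y : ℂ) • w) : inner ℂ v w = 0 := by
  have h := hB v w
  rw [hv, hw, inner_smul_left, inner_smul_right, Complex.conj_ofReal, ← sub_eq_zero,
    ← sub_mul] at h
  refine (mul_eq_zero.mp h).resolve_left ?_
  rw [sub_eq_zero]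
  exact_mod_cast hxy

/-- The orthogonal complement of the ground space inside `S` is invariant and contains the
eigenvectors of every other eigenvalue. The least eigenvalue of this restriction is therefore the
first excited energy. -/
theorem localGap_spec {S : Submodule ℂ E} {A : E →L[ℂ] E} (hA : IsSelfAdjoint A)
    (hne : (localSpectrum S A).Nontrivial) :
    0 < localGap S A ∧ ∀ w ∈ S, w ∈ (groundSpace S A)ᗮ →
      (groundEnergy S A + localGap S A) * ‖w‖ ^ 2 ≤ (inner ℂ (block S A w) w).re := by
  have hsym := block_isSymmetric S hA
  obtain ⟨hg, -⟩ := isLeast_groundEnergy hA hne.nonempty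
  set K : Submodule ℂ E := S ⊓ (groundSpace S A)ᗮ
  have hex : ∀ x ∈ localSpectrum S A \ {groundEnergy S A},
      ∃ v ∈ K, v ≠ 0 ∧ block S A v = (x : ℂ) • v := by
    rintro x ⟨⟨v, hv, hv0, hBv⟩, hx⟩
    refine ⟨v, ⟨hv, ?_⟩, hv0, hBv⟩
    rw [SetLike.mem_coe, Submodule.mem_orthogonal]
    intro u hu
    exact inner_eigenvector_eq_zero hsym (Ne.symm hx) (mem_groundSpace.mp hu).2 hBv
  obtain ⟨x, hx, hxg⟩ := hne.exists_ne (groundEnergy S A)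
  have hKbot : K ≠ ⊥ := by
    intro h
    obtain ⟨v, hv, hv0, -⟩ := hex x ⟨hx, hxg⟩
    rw [h] at hv
    exact hv0 (by simpa using hv)
  have hinv : ∀ v ∈ K, (block S A : E →ₗ[ℂ] E) v ∈ K := by
    rintro v ⟨-, hv⟩
    refine ⟨block_apply_mem S A v, ?_⟩
    rw [SetLike.mem_coe, Submodule.mem_orthogonal] at hv ⊢
    intro u hu
    rw [← hsym u v]
    have := (mem_groundSpace.mp hu).2
    rw [ContinuousLinearMap.coe_coe, this, inner_smul_left, hv u hu, mul_zero]
  obtain ⟨ν, ⟨v, hvK, hv0, hBv⟩, hle⟩ := exists_least_eigenvalue_of_invariant hsym hKbot hinv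
  have hνg : ν ≠ groundEnergy S A := by
    rintro rfl
    have hvg : v ∈ groundSpace S A := mem_groundSpace.mpr ⟨hvK.1, hBv⟩
    exact hv0 (by simpa using (Submodule.mem_orthogonal _ _).mp hvK.2 v hvg)
  have hνmem : ν ∈ localSpectrum S A := ⟨v, hvK.1, hv0, hBv⟩
  have hleast : IsLeast (localSpectrum S A \ {groundEnergy S A}) ν :=
    isLeast_of_eigenvalue_le ⟨hνmem, hνg⟩ hex hle
  have hν : firstExcitedEnergy S A = ν := hleast.csInf_eq
  have hsum : groundEnergy S A + localGap S A = ν := by rw [localGap, hν]; ring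
  rw [hsum]
  refine ⟨?_, fun w hw hw' => hle w ⟨hw, hw'⟩⟩
  rw [localGap, hν, sub_pos]
  exact lt_of_le_of_ne (hg.2 hνmem) (Ne.symm hνg)

theorem groundSpace_ne_bot {S : Submodule ℂ E} {A : E →L[ℂ] E} (hA : IsSelfAdjoint A)
    (hne : (localSpectrum S A).Nonempty) : groundSpace S A ≠ ⊥ := by
  obtain ⟨v, hv, hv0, hBv⟩ := (isLeast_groundEnergy hA hne).1.1
  intro h
  have : v ∈ groundSpace S A := mem_groundSpace.mpr ⟨hv, hBv⟩
  rw [h] at this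
  exact hv0 (by simpa using this)

/-- One half of Weyl's inequality: a ground vector of `B` serves as trial vector for `A`. -/
theorem groundEnergy_le_add_norm {S : Submodule ℂ E} {A B : E →L[ℂ] E} (hA : IsSelfAdjoint A)
    (hB : IsSelfAdjoint B) (hneA : (localSpectrum S A).Nonempty)
    (hneB : (localSpectrum S B).Nonempty) :
    groundEnergy S A ≤ groundEnergy S B + ‖block S A - block S B‖ := by
  obtain ⟨v, hv, hv0, hBv⟩ := (isLeast_groundEnergy hB hneB).1.1
  have h1 := (isLeast_groundEnergy hA hneA).2 v hv
  have hpos : 0 < ‖v‖ ^ 2 := by positivity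
  refine le_of_mul_le_mul_right (h1.trans ?_) hpos
  have hsplit : block S A v = (block S A - block S B) v + block S B v := by simp
  rw [hsplit, inner_add_left, Complex.add_re, hBv, inner_smul_left, inner_self_eq_norm_sq_to_K,
    add_mul, add_comm]
  have hre : ((starRingEnd ℂ) ((groundEnergy S B : ℝ) : ℂ) * ((‖v‖ : ℝ) : ℂ) ^ 2).re
      = groundEnergy S B * ‖v‖ ^ 2 := by
    rw [Complex.conj_ofReal]
    norm_cast
  refine add_le_add hre.le ?_
  calc (inner ℂ ((block S A - block S B) v) v).re
      ≤ ‖(block S A - block S B) v‖ * ‖v‖ := re_inner_le_norm (𝕜 := ℂ) _ _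
    _ ≤ (‖block S A - block S B‖ * ‖v‖) * ‖v‖ := by
        gcongr
        exact ContinuousLinearMap.le_opNorm _ _
    _ = ‖block S A - block S B‖ * ‖v‖ ^ 2 := by ring

theorem abs_groundEnergy_sub_le {S : Submodule ℂ E} {A B : E →L[ℂ] E} (hA : IsSelfAdjoint A)
    (hB : IsSelfAdjoint B) (hneA : (localSpectrum S A).Nonempty)
    (hneB : (localSpectrum S B).Nonempty) :
    |groundEnergy S A - groundEnergy S B| ≤ ‖block S A - block S B‖ := by
  have h1 := groundEnergy_le_add_norm hA hB hneA hneB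
  have h2 := groundEnergy_le_add_norm hB hA hneB hneA
  rw [norm_sub_rev] at h2
  rw [abs_le]
  constructor <;> linarith

end Static

/-! ### Reduced resolvents in a ring -/

/-- `r` is the reduced resolvent of `a`, an operator on the range of the projection `k` with kernel
the range of the projection `p`. -/
structure IsReducedResolvent {R : Type*} [Ring R] (k p a r : R) : Prop where
  kk : k * k = k
  pp : p * p = p
  kp : k * p = p
  pk : p * k = p
  ka : k * a = a
  ak : a * k = a
  ap : a * p = 0
  pa : p * a = 0
  ar : a * r = k - p
  ra : r * a = k - p
  rp : r * p = 0
  pr : p * r = 0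
  kr : k * r = r
  rk : r * k = r

/-- Along `1 = (k - p) + p + (1 - k)` the sum `a + p + (1 - k)` acts as `a` on the first summand and
as the identity on the other two. Inverting it and removing both identities leaves the
pseudo-inverse of `a`. -/
theorem isReducedResolvent_of_isUnit {R : Type*} [Ring R] {k p a : R} (kk : k * k = k)
    (pp : p * p = p) (kp : k * p = p) (pk : p * k = p) (ka : k * a = a) (ak : a * k = a)
    (ap : a * p = 0) (pa : p * a = 0) (hu : IsUnit (a + p + (1 - k))) :
    IsReducedResolvent k p a (Ring.inverse (a + p + (1 - k)) - p - (1 - k)) := by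
  set b := a + p + (1 - k) with hb
  set c := Ring.inverse b with hc
  have hcb : c * b = 1 := Ring.inverse_mul_cancel _ hu
  have hbc : b * c = 1 := Ring.mul_inverse_cancel _ hu
  have hbp : b * p = p := by rw [hb]; simp [add_mul, sub_mul, ap, pp, kp]
  have hpb : p * b = p := by rw [hb]; simp [mul_add, mul_sub, pa, pp, pk]
  have hbk : b * k = a + p := by rw [hb]; simp [add_mul, sub_mul, ak, kk, pk]
  have hkb : k * b = a + p := by rw [hb]; simp [mul_add, mul_sub, ka, kk, kp]
  have hcp : c * p = p := by rw [← hbp, ← mul_assoc, hcb, one_mul, hbp]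
  have hpc : p * c = p := by rw [← hpb, mul_assoc, hbc, mul_one, hpb]
  have hck : c * k = k * c := by
    calc c * k = c * (k * b) * c := by rw [mul_assoc, mul_assoc, hbc, mul_one]
      _ = c * (b * k) * c := by rw [hkb, hbk]
      _ = k * c := by rw [← mul_assoc c b k, hcb, one_mul]
  have hkc : k * c = c - (1 - k) := by
    have h : b * (1 - k) = 1 - k := by
      rw [mul_sub, hbk, mul_one, hb]; abel
    have h2 : c * (1 - k) = 1 - k := by
      calc c * (1 - k) = c * (b * (1 - k)) := by rw [h]
        _ = 1 - k := by rw [← mul_assoc, hcb, one_mul]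
    rw [← hck, ← h2]; simp [mul_sub]
  refine ⟨kk, pp, kp, pk, ka, ak, ap, pa, ?_, ?_, ?_, ?_, ?_, ?_⟩
  · have : a * c = k - p := by
      have : a = k * b - p := by rw [hkb]; abel
      rw [this, sub_mul, mul_assoc, hbc, mul_one, hpc]
    simp [mul_sub, this, ap, ak]
  · have : c * a = k - p := by
      have : a = b * k - p := by rw [hbk]; abel
      rw [this, mul_sub, ← mul_assoc, hcb, one_mul, hcp]
    simp [sub_mul, this, pa, ka]
  · simp [sub_mul, hcp, pp, kp]
  · simp [mul_sub, hpc, pp, pk]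
  · simp [mul_sub, hkc, kp, kk, sub_right_comm]
  · simp [sub_mul, hck, hkc, pk, kk, sub_right_comm]

/-! ### The reduced resolvent of a block and its norm -/

section Resolvent

variable {E : Type*} [NormedAddCommGroup E] [InnerProductSpace ℂ E] [FiniteDimensional ℂ E]

/-- The operator `A_S - μ` on `S`, extended by zero. -/
noncomputable def excitation (S : Submodule ℂ E) (A : E →L[ℂ] E) : E →L[ℂ] E :=
  block S A - ((groundEnergy S A : ℝ) : ℂ) • S.starProjection

/-- The pseudo-inverse of `A_S - μ` on `S`, extended by zero. -/
noncomputable def reducedResolvent (S : Submodule ℂ E) (A : E →L[ℂ] E) : E →L[ℂ] E :=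
  Ring.inverse (excitation S A + groundProj S A + (1 - S.starProjection)) - groundProj S A
    - (1 - S.starProjection)

theorem starProjection_mul_self (S : Submodule ℂ E) :
    S.starProjection * S.starProjection = S.starProjection :=
  S.isIdempotentElem_starProjection

theorem starProjection_mul_groundProj (S : Submodule ℂ E) (A : E →L[ℂ] E) :
    S.starProjection * groundProj S A = groundProj S A := by
  ext v
  exact Submodule.starProjection_eq_self_iff.mpr
    (groundSpace_le S A (Submodule.starProjection_apply_mem _ v))

theorem groundProj_mul_starProjection (S : Submodule ℂ E) (A : E →L[ℂ] E) :
    groundProj S A * S.starProjection = groundProj S A :=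
  Submodule.starProjection_comp_starProjection_of_le (groundSpace_le S A)

theorem isSelfAdjoint_groundProj (S : Submodule ℂ E) (A : E →L[ℂ] E) :
    IsSelfAdjoint (groundProj S A) := isSelfAdjoint_starProjection _

theorem groundProj_mul_self (S : Submodule ℂ E) (A : E →L[ℂ] E) :
    groundProj S A * groundProj S A = groundProj S A := starProjection_mul_self _

theorem isSelfAdjoint_excitation (S : Submodule ℂ E) {A : E →L[ℂ] E} (hA : IsSelfAdjoint A) :
    IsSelfAdjoint (excitation S A) := by
  refine (block_isSelfAdjoint S hA).sub ?_
  rw [isSelfAdjoint_iff, star_smul, (isSelfAdjoint_starProjection S).star_eq]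
  simp

theorem excitation_mul_groundProj (S : Submodule ℂ E) (A : E →L[ℂ] E) :
    excitation S A * groundProj S A = 0 := by
  ext v
  have h := mem_groundSpace.mp (Submodule.starProjection_apply_mem (groundSpace S A) v)
  have h1 := Submodule.starProjection_eq_self_iff.mpr h.1
  simp only [excitation, groundProj, mul_apply_eq_comp, sub_apply,
    smul_apply, h1, h.2, sub_self, zero_apply]

theorem groundProj_mul_excitation (S : Submodule ℂ E) {A : E →L[ℂ] E} (hA : IsSelfAdjoint A) :
    groundProj S A * excitation S A = 0 := by
  have h := congrArg star (excitation_mul_groundProj S A)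
  rwa [star_mul, (isSelfAdjoint_groundProj S A).star_eq, (isSelfAdjoint_excitation S hA).star_eq,
    star_zero] at h

theorem starProjection_mul_block (S : Submodule ℂ E) (A : E →L[ℂ] E) :
    S.starProjection * block S A = block S A := by
  simp only [block, ← mul_assoc, starProjection_mul_self]

theorem block_mul_starProjection (S : Submodule ℂ E) (A : E →L[ℂ] E) :
    block S A * S.starProjection = block S A := by
  simp only [block, mul_assoc, starProjection_mul_self]

theorem starProjection_mul_excitation (S : Submodule ℂ E) (A : E →L[ℂ] E) :
    S.starProjection * excitation S A = excitation S A := by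
  simp [excitation, mul_sub, starProjection_mul_block, starProjection_mul_self]

theorem excitation_mul_starProjection (S : Submodule ℂ E) (A : E →L[ℂ] E) :
    excitation S A * S.starProjection = excitation S A := by
  simp [excitation, sub_mul, block_mul_starProjection, starProjection_mul_self]

/-- Cauchy–Schwarz turns the gap bound on the quadratic form into a lower bound on the operator.
Invertibility and the resolvent norm both follow from it. -/
theorem localGap_mul_norm_le {S : Submodule ℂ E} {A : E →L[ℂ] E} (hA : IsSelfAdjoint A)
    (hne : (localSpectrum S A).Nontrivial) {w : E} (hw : S.starProjection w = w)
    (hw' : groundProj S A w = 0) : localGap S A * ‖w‖ ≤ ‖excitation S A w‖ := by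
  rcases eq_or_ne w 0 with rfl | h0
  · simp
  have hwS : w ∈ S := Submodule.starProjection_eq_self_iff.mp hw
  have hwG : w ∈ (groundSpace S A)ᗮ := by
    rw [← Submodule.ker_starProjection]; exact hw'
  have h := (localGap_spec hA hne).2 w hwS hwG
  have hre : (inner ℂ (excitation S A w) w).re
      = (inner ℂ (block S A w) w).re - groundEnergy S A * ‖w‖ ^ 2 := by
    rw [excitation, sub_apply, smul_apply, hw,
      inner_sub_left, inner_smul_left, inner_self_eq_norm_sq_to_K, Complex.sub_re,
      Complex.conj_ofReal]
    congr 1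
    change (((groundEnergy S A : ℝ) : ℂ) * ((‖w‖ : ℝ) : ℂ) ^ 2).re = _
    norm_cast
  have h2 : (inner ℂ (excitation S A w) w).re ≤ ‖excitation S A w‖ * ‖w‖ :=
    re_inner_le_norm (𝕜 := ℂ) _ _
  have hpos : 0 < ‖w‖ := norm_pos_iff.mpr h0
  refine le_of_mul_le_mul_right ?_ hpos
  nlinarith

theorem isUnit_excitation_add {S : Submodule ℂ E} {A : E →L[ℂ] E} (hA : IsSelfAdjoint A)
    (hne : (localSpectrum S A).Nontrivial) :
    IsUnit (excitation S A + groundProj S A + (1 - S.starProjection)) := by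
  set b := excitation S A + groundProj S A + (1 - S.starProjection) with hb
  have hpb : groundProj S A * b = groundProj S A := by
    rw [hb]
    simp [mul_add, mul_sub, groundProj_mul_excitation S hA, groundProj_mul_self,
      groundProj_mul_starProjection]
  have hkb : (1 - S.starProjection) * b = 1 - S.starProjection := by
    rw [hb]
    simp [mul_add, mul_sub, sub_mul, starProjection_mul_excitation, starProjection_mul_groundProj,
      starProjection_mul_self]
  have hinj : Function.Injective (b : E →ₗ[ℂ] E) := by
    rw [← LinearMap.ker_eq_bot, LinearMap.ker_eq_bot']
    intro w hw
    have hw : b w = 0 := hw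
    have h1 : groundProj S A w = 0 := by
      rw [← hpb, mul_apply_eq_comp, hw, map_zero]
    have h2 : (1 - S.starProjection : E →L[ℂ] E) w = 0 := by
      rw [← hkb, mul_apply_eq_comp, hw, map_zero]
    have h3 : excitation S A w = 0 := by
      have : b w = excitation S A w + groundProj S A w + (1 - S.starProjection : E →L[ℂ] E) w := rfl
      rw [h1, h2, hw] at this
      simpa using this.symm
    have h4 : S.starProjection w = w := by
      have : w - S.starProjection w = 0 := h2
      exact (sub_eq_zero.mp this).symm
    have h5 := localGap_mul_norm_le hA hne h4 h1
    rw [h3, norm_zero] at h5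
    have h6 := (localGap_spec hA hne).1
    have : ‖w‖ ≤ 0 := nonpos_of_mul_nonpos_right h5 h6
    simpa using this
  have hbij : Function.Bijective b := ⟨hinj, LinearMap.injective_iff_surjective.mp hinj⟩
  rw [ContinuousLinearMap.isUnit_iff_bijective]
  exact hbij

theorem isReducedResolvent {S : Submodule ℂ E} {A : E →L[ℂ] E} (hA : IsSelfAdjoint A)
    (hne : (localSpectrum S A).Nontrivial) :
    IsReducedResolvent S.starProjection (groundProj S A) (excitation S A)
      (reducedResolvent S A) :=
  isReducedResolvent_of_isUnit (starProjection_mul_self S) (groundProj_mul_self S A)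
    (starProjection_mul_groundProj S A) (groundProj_mul_starProjection S A)
    (starProjection_mul_excitation S A) (excitation_mul_starProjection S A)
    (excitation_mul_groundProj S A) (groundProj_mul_excitation S hA) (isUnit_excitation_add hA hne)

theorem norm_groundProj_le (S : Submodule ℂ E) (A : E →L[ℂ] E) : ‖groundProj S A‖ ≤ 1 :=
  Submodule.starProjection_norm_le _

theorem norm_starProjection_sub_apply_le {K L : Submodule ℂ E} (h : K ≤ L) (v : E) :
    ‖(L.starProjection - K.starProjection) v‖ ≤ ‖v‖ := by
  have hc : K.starProjection (L.starProjection v) = K.starProjection v :=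
    congrArg (fun f : E →L[ℂ] E => f v) (Submodule.starProjection_comp_starProjection_of_le h)
  have : (L.starProjection - K.starProjection) v = Kᗮ.starProjection (L.starProjection v) := by
    rw [Submodule.starProjection_orthogonal_val, hc]; rfl
  rw [this]
  exact (Submodule.norm_starProjection_apply_le _ _).trans
    (Submodule.norm_starProjection_apply_le _ _)

/-- The lower bound is applied to `r v`, whose image under the excitation is `(P_S - P) v`. -/
theorem norm_reducedResolvent_le {S : Submodule ℂ E} {A : E →L[ℂ] E} (hA : IsSelfAdjoint A)
    (hne : (localSpectrum S A).Nontrivial) : ‖reducedResolvent S A‖ ≤ 1 / localGap S A := by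
  have hr := isReducedResolvent hA hne
  have hpos := (localGap_spec hA hne).1
  refine ContinuousLinearMap.opNorm_le_bound _ (by positivity) fun v => ?_
  have h1 : S.starProjection (reducedResolvent S A v) = reducedResolvent S A v :=
    congrArg (fun f : E →L[ℂ] E => f v) hr.kr
  have h2 : groundProj S A (reducedResolvent S A v) = 0 :=
    congrArg (fun f : E →L[ℂ] E => f v) hr.pr
  have h3 : excitation S A (reducedResolvent S A v)
      = (S.starProjection - groundProj S A) v :=
    congrArg (fun f : E →L[ℂ] E => f v) hr.ar
  have h4 := localGap_mul_norm_le hA hne h1 h2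
  rw [h3] at h4
  have h5 : ‖(S.starProjection - groundProj S A) v‖ ≤ ‖v‖ :=
    norm_starProjection_sub_apply_le (groundSpace_le S A) v
  rw [one_div, inv_mul_eq_div, le_div_iff₀ hpos]
  linarith

end Resolvent

/-! ### Differentiability of the ground energy, projection and resolvent -/

open Filter Topology Asymptotics

/-- As `f x = 0`, the difference quotient of the product is that of `f` times `g`, so continuity of
`g` suffices. This permits differentiating products with the ground projection before it is known to
be differentiable. -/
theorem hasDerivWithinAt_mul_of_eq_zero {𝔸 : Type*} [NormedRing 𝔸] [NormedAlgebra ℝ 𝔸]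
    {f g : ℝ → 𝔸} {f' : 𝔸} {X : Set ℝ} {x : ℝ} (hf : HasDerivWithinAt f f' X x) (h0 : f x = 0)
    (hg : ContinuousWithinAt g X x) :
    HasDerivWithinAt (fun t => f t * g t) (f' * g x) X x := by
  rw [hasDerivWithinAt_iff_tendsto_slope] at hf ⊢
  refine (hf.mul (hg.mono_left (nhdsWithin_mono x sdiff_subset))).congr fun t => ?_
  simp [slope_def_module, h0]

section Perturbation

variable {E : Type*} [NormedAddCommGroup E] [InnerProductSpace ℂ E] [FiniteDimensional ℂ E]

/-- Two subspaces of equal dimension, one of which is close to the other, are close to each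
other. -/
theorem norm_one_sub_starProjection_mul_le {K L : Submodule ℂ E}
    (hdim : Module.finrank ℂ K = Module.finrank ℂ L) {ε : ℝ} (hε : ε ≤ 1 / 2)
    (h : ‖(1 - L.starProjection) * K.starProjection‖ ≤ ε) :
    ‖(1 - K.starProjection) * L.starProjection‖ ≤ 2 * ε := by
  have hε0 : 0 ≤ ε := (norm_nonneg _).trans h
  have hK : ∀ v ∈ K, ‖v - L.starProjection v‖ ≤ ε * ‖v‖ := by
    intro v hv
    have h1 := ((1 - L.starProjection) * K.starProjection).le_of_opNorm_le h v
    rwa [mul_apply_eq_comp, Submodule.starProjection_eq_self_iff.mpr hv] at h1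
  have hnorm : ∀ v ∈ K, ‖v‖ ≤ 2 * ‖L.starProjection v‖ := by
    intro v hv
    have h1 := hK v hv
    have h2 : ‖v‖ ≤ ‖v - L.starProjection v‖ + ‖L.starProjection v‖ := by
      simpa using norm_add_le (v - L.starProjection v) (L.starProjection v)
    nlinarith [norm_nonneg v]
  have hmaps : ∀ v ∈ K, (L.starProjection : E →ₗ[ℂ] E) v ∈ L :=
    fun v _ => Submodule.starProjection_apply_mem L v
  -- Equal dimensions upgrade injectivity to surjectivity: each `y ∈ L` is the projection of some `v
  -- ∈ K` with `‖v‖ ≤ 2 ‖y‖`, and this `v` is a competitor for the distance from `y` to `K`.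
  have hinj : Function.Injective ((L.starProjection : E →ₗ[ℂ] E).restrict hmaps) := by
    rw [← LinearMap.ker_eq_bot, LinearMap.ker_eq_bot']
    intro v hv
    have h1 : L.starProjection (v : E) = 0 := congrArg Subtype.val hv
    have h2 := hnorm v v.2
    rw [h1, norm_zero, mul_zero] at h2
    exact Subtype.ext (by simpa using h2)
  have hsurj := (LinearMap.injective_iff_surjective_of_finrank_eq_finrank hdim).mp hinj
  refine ContinuousLinearMap.opNorm_le_bound _ (by positivity) fun x => ?_
  obtain ⟨⟨v, hv⟩, hvx⟩ := hsurj ⟨L.starProjection x, Submodule.starProjection_apply_mem L x⟩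
  have hvx : L.starProjection v = L.starProjection x := congrArg Subtype.val hvx
  rw [mul_apply_eq_comp]
  have hmin : ‖L.starProjection x - K.starProjection (L.starProjection x)‖
      ≤ ‖L.starProjection x - v‖ := by
    rw [Submodule.starProjection_minimal]
    exact ciInf_le ⟨0, by rintro _ ⟨y, rfl⟩; exact norm_nonneg _⟩ (⟨v, hv⟩ : K)
  refine hmin.trans ?_
  rw [← hvx, norm_sub_rev]
  have h1 := hK v hv
  have h2 := hnorm v hv
  have h3 := Submodule.norm_starProjection_apply_le L x
  rw [hvx] at h2
  nlinarith

theorem norm_starProjection_sub_le {K L : Submodule ℂ E}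
    (hdim : Module.finrank ℂ K = Module.finrank ℂ L) {ε : ℝ} (hε : ε ≤ 1 / 2)
    (h : ‖(1 - L.starProjection) * K.starProjection‖ ≤ ε) :
    ‖K.starProjection - L.starProjection‖ ≤ 3 * ε := by
  have h2 := norm_one_sub_starProjection_mul_le hdim hε h
  have h3 : ‖K.starProjection * (1 - L.starProjection)‖ ≤ ε := by
    rw [← norm_star, star_mul, star_sub, star_one, (isSelfAdjoint_starProjection K).star_eq,
      (isSelfAdjoint_starProjection L).star_eq]
    exact h
  have heq : K.starProjection - L.starProjection
      = K.starProjection * (1 - L.starProjection) - (1 - K.starProjection) * L.starProjection := by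
    simp [mul_sub, sub_mul]
  rw [heq]
  linarith [norm_sub_le (K.starProjection * (1 - L.starProjection))
    ((1 - K.starProjection) * L.starProjection)]

/-- A differentiable family of Hermitian operators on `S` whose ground energy has constant
multiplicity and is separated by a gap. -/
structure IsGappedFamily (S : Submodule ℂ E) (H : ℝ → E →L[ℂ] E) : Prop where
  isSelfAdjoint : ∀ s ∈ Icc (0 : ℝ) 1, IsSelfAdjoint (H s)
  differentiableOn : DifferentiableOn ℝ (fun t => block S (H t)) (Icc 0 1)
  nontrivial : ∀ s ∈ Icc (0 : ℝ) 1, (localSpectrum S (H s)).Nontrivial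
  finrank_eq : ∀ s ∈ Icc (0 : ℝ) 1, ∀ t ∈ Icc (0 : ℝ) 1,
    Module.finrank ℂ (groundSpace S (H s)) = Module.finrank ℂ (groundSpace S (H t))

namespace IsGappedFamily

variable {S : Submodule ℂ E} {H : ℝ → E →L[ℂ] E} (hH : IsGappedFamily S H) {s : ℝ}

include hH

theorem continuousWithinAt_groundEnergy (hs : s ∈ Icc (0 : ℝ) 1) :
    ContinuousWithinAt (fun t => groundEnergy S (H t)) (Icc 0 1) s := by
  have hc := (hH.differentiableOn s hs).continuousWithinAt
  rw [ContinuousWithinAt, tendsto_iff_norm_sub_tendsto_zero] at hc ⊢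
  refine squeeze_zero' (Eventually.of_forall fun _ => norm_nonneg _) ?_ hc
  filter_upwards [self_mem_nhdsWithin] with t ht
  exact abs_groundEnergy_sub_le (hH.isSelfAdjoint t ht) (hH.isSelfAdjoint s hs)
    (hH.nontrivial t ht).nonempty (hH.nontrivial s hs).nonempty

/-- Expand using `r a_s = P_S - P_s` and `a_t P_t = 0`. The off-diagonal part of `P_t` is thus of
first order in the change of the excitation, without remainder. -/
theorem one_sub_mul_groundProj {t : ℝ} (hs : s ∈ Icc (0 : ℝ) 1) :
    (1 - groundProj S (H s)) * groundProj S (H t) =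
      -(reducedResolvent S (H s) * (excitation S (H t) - excitation S (H s))) *
        groundProj S (H t) := by
  have hr := isReducedResolvent (hH.isSelfAdjoint s hs) (hH.nontrivial s hs)
  have h1 := excitation_mul_groundProj S (H t)
  have h2 := starProjection_mul_groundProj S (H t)
  rw [mul_sub, hr.ra, neg_mul, sub_mul, sub_mul, mul_assoc, h1]
  simp [sub_mul, h2]

theorem exists_norm_groundProj_sub_le (hs : s ∈ Icc (0 : ℝ) 1)
    (hc : ContinuousWithinAt (fun t => excitation S (H t)) (Icc 0 1) s) :
    ∃ C : ℝ, ∀ᶠ t in 𝓝[Icc 0 1] s, ‖groundProj S (H t) - groundProj S (H s)‖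
      ≤ C * ‖excitation S (H t) - excitation S (H s)‖ := by
  refine ⟨3 * ‖reducedResolvent S (H s)‖, ?_⟩
  have hlim : Tendsto (fun t => ‖reducedResolvent S (H s)‖ *
      ‖excitation S (H t) - excitation S (H s)‖) (𝓝[Icc 0 1] s) (𝓝 0) := by
    have := (tendsto_iff_norm_sub_tendsto_zero.mp hc).const_mul ‖reducedResolvent S (H s)‖
    simpa using this
  filter_upwards [self_mem_nhdsWithin, hlim.eventually_le_const (by norm_num : (0 : ℝ) < 1 / 2)]
    with t ht hle
  rw [mul_assoc]
  refine norm_starProjection_sub_le (hH.finrank_eq t ht s hs) hle ?_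
  have := hH.one_sub_mul_groundProj (t := t) hs
  rw [groundProj, groundProj] at this
  rw [this]
  calc _ ≤ ‖-(reducedResolvent S (H s) * (excitation S (H t) - excitation S (H s)))‖ * 1 := by
        refine (norm_mul_le _ _).trans ?_
        gcongr
        exact Submodule.starProjection_norm_le _
    _ ≤ _ := by
        rw [mul_one, norm_neg]
        exact norm_mul_le _ _

theorem continuousWithinAt_excitation (hs : s ∈ Icc (0 : ℝ) 1) :
    ContinuousWithinAt (fun t => excitation S (H t)) (Icc 0 1) s := by
  have h := Complex.continuous_ofReal.continuousAt.comp_continuousWithinAt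
    (hH.continuousWithinAt_groundEnergy hs)
  exact (hH.differentiableOn s hs).continuousWithinAt.sub (h.smul continuousWithinAt_const)

theorem continuousWithinAt_groundProj (hs : s ∈ Icc (0 : ℝ) 1) :
    ContinuousWithinAt (fun t => groundProj S (H t)) (Icc 0 1) s := by
  have hc := hH.continuousWithinAt_excitation hs
  obtain ⟨C, hC⟩ := hH.exists_norm_groundProj_sub_le hs hc
  rw [ContinuousWithinAt, tendsto_iff_norm_sub_tendsto_zero] at hc ⊢
  refine squeeze_zero' (Eventually.of_forall fun _ => norm_nonneg _) hC ?_
  simpa using hc.const_mul C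

/-- The operator at `t` acts to the right as its ground energy and the one at `s` acts to the left
as its own: first-order perturbation theory as an exact identity. -/
theorem groundEnergy_sub_smul {t : ℝ} (hs : s ∈ Icc (0 : ℝ) 1) :
    groundProj S (H s) * (block S (H t) - block S (H s)) * groundProj S (H t)
      = ((groundEnergy S (H t) - groundEnergy S (H s) : ℝ) : ℂ) •
        (groundProj S (H s) * groundProj S (H t)) := by
  have h1 := excitation_mul_groundProj S (H t)
  have h2 := groundProj_mul_excitation S (hH.isSelfAdjoint s hs)
  rw [excitation, sub_mul, sub_eq_zero, smul_mul_assoc, starProjection_mul_groundProj] at h1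
  rw [excitation, mul_sub, sub_eq_zero, mul_smul_comm, groundProj_mul_starProjection] at h2
  rw [mul_sub, sub_mul, mul_assoc, h1, h2, mul_smul_comm, smul_mul_assoc, ← sub_smul]
  push_cast
  rfl

theorem differentiableWithinAt_groundEnergy (hs : s ∈ Icc (0 : ℝ) 1) :
    DifferentiableWithinAt ℝ (fun t => groundEnergy S (H t)) (Icc 0 1) s := by
  obtain ⟨v, hv, hv0⟩ := Submodule.exists_mem_ne_zero_of_ne_bot
    (groundSpace_ne_bot (hH.isSelfAdjoint s hs) (hH.nontrivial s hs).nonempty)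
  have hPv : groundProj S (H s) v = v := Submodule.starProjection_eq_self_iff.mpr hv
  have hP := hH.continuousWithinAt_groundProj hs
  -- The matrix element at a ground vector `v` of `H s`. Dividing by `⟨v, P_t v⟩`, nonzero for `t`
  -- near `s`, isolates the difference of the ground energies.
  let L : (E →L[ℂ] E) →L[ℝ] ℂ :=
    ((innerSL ℂ v).comp (ContinuousLinearMap.apply ℂ E v)).restrictScalars ℝ
  have hL : ∀ A, L A = inner ℂ v (A v) := fun _ => rfl
  have hLP : ∀ A, L (groundProj S (H s) * A) = L A := by
    intro A
    rw [hL, hL, mul_apply_eq_comp, groundProj, ← Submodule.inner_starProjection_left_eq_right]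
    congr 1
  have hnum : HasDerivWithinAt (fun t => L ((block S (H t) - block S (H s)) * groundProj S (H t)))
      _ (Icc 0 1) s := L.hasFDerivAt.comp_hasDerivWithinAt s
    (hasDerivWithinAt_mul_of_eq_zero
      ((hH.differentiableOn s hs).hasDerivWithinAt.sub_const (block S (H s))) (sub_self _) hP)
  have hden : ContinuousWithinAt (fun t => L (groundProj S (H t))) (Icc 0 1) s :=
    L.continuous.continuousAt.comp_continuousWithinAt hP
  have hden0 : L (groundProj S (H s)) ≠ 0 := by
    rw [hL, hPv]
    exact inner_self_ne_zero.mpr hv0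
  have hquot := hasDerivWithinAt_mul_of_eq_zero hnum (by simp) (hden.inv₀ hden0)
  have hre := Complex.reCLM.hasFDerivAt.comp_hasDerivWithinAt s hquot
  have hre' := (hre.add_const (groundEnergy S (H s))).differentiableWithinAt
  refine hre'.congr_of_eventuallyEq_of_mem ?_ hs
  filter_upwards [hden.eventually_ne hden0] with t ht
  have h1 : L ((block S (H t) - block S (H s)) * groundProj S (H t))
      = ((groundEnergy S (H t) - groundEnergy S (H s) : ℝ) : ℂ) * L (groundProj S (H t)) := by
    rw [← hLP, ← mul_assoc, hH.groundEnergy_sub_smul hs, ← hLP (groundProj S (H t)), hL, hL,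
      smul_apply, inner_smul_right]
  have h2 : L (groundProj S (H t)) * (fun t => L (groundProj S (H t)))⁻¹ t = 1 :=
    mul_inv_cancel₀ ht
  rw [Function.comp, h1, mul_assoc, h2, mul_one]
  simp

theorem differentiableWithinAt_excitation (hs : s ∈ Icc (0 : ℝ) 1) :
    DifferentiableWithinAt ℝ (fun t => excitation S (H t)) (Icc 0 1) s := by
  have h : DifferentiableWithinAt ℝ (fun t => ((groundEnergy S (H t) : ℝ) : ℂ)) (Icc 0 1) s :=
    Complex.ofRealCLM.differentiableAt.comp_differentiableWithinAt s
      (hH.differentiableWithinAt_groundEnergy hs)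
  exact (hH.differentiableOn s hs).sub (h.smul_const S.starProjection)

/-- Relative to `P_s`, the off-diagonal part is handled by `one_sub_mul_groundProj` and its adjoint.
The remaining block `P_s P_t P_s` differs from `P_s` by `P_s (P_t - P_s)² P_s`, which is `O(|t -
s|²)`. -/
theorem differentiableWithinAt_groundProj (hs : s ∈ Icc (0 : ℝ) 1) :
    DifferentiableWithinAt ℝ (fun t => groundProj S (H t)) (Icc 0 1) s := by
  set P := fun t => groundProj S (H t) with hPdef
  have ha := hH.differentiableWithinAt_excitation hs
  have hoff : DifferentiableWithinAt ℝ (fun t => (1 - P s) * P t) (Icc 0 1) s := by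
    simp only [hPdef, hH.one_sub_mul_groundProj hs]
    exact (hasDerivWithinAt_mul_of_eq_zero
      ((ha.hasDerivWithinAt.sub_const (excitation S (H s))).const_mul
        (reducedResolvent S (H s))).neg (by simp)
      (hH.continuousWithinAt_groundProj hs)).differentiableWithinAt
  have hoff' : DifferentiableWithinAt ℝ (fun t => P t * (1 - P s)) (Icc 0 1) s := by
    have heq : ∀ t, P t * (1 - P s) = star ((1 - P s) * P t) := fun t => by
      simp [hPdef, (isSelfAdjoint_groundProj S (H _)).star_eq]
    exact hoff.star.congr (fun t _ => heq t) (heq s)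
  obtain ⟨C, hC⟩ := hH.exists_norm_groundProj_sub_le hs ha.continuousWithinAt
  have hO : (fun t => P t - P s) =O[𝓝[Icc 0 1] s] fun t => t - s :=
    (IsBigO.of_bound C hC).trans ha.hasFDerivWithinAt.isBigO_sub
  have hsq : DifferentiableWithinAt ℝ (fun t => P s * ((P t - P s) * (P t - P s)) * P s)
      (Icc 0 1) s := by
    have h2 : (fun t => (P t - P s) * (P t - P s)) =O[𝓝[Icc 0 1] s] fun t => ‖t - s‖ ^ 2 := by
      refine (hO.mul hO).congr_right fun t => ?_
      rw [Real.norm_eq_abs, sq_abs, sq]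
    exact ((h2.hasFDerivWithinAt hs one_lt_two).differentiableWithinAt.const_mul (P s)).mul_const
      (P s)
  have hsum := ((hoff.mul_const (P s)).add hoff').sub hsq |>.add_const (P s)
  have heq : ∀ t, P t = (1 - P s) * P t * P s + P t * (1 - P s)
      - P s * ((P t - P s) * (P t - P s)) * P s + P s := by
    intro t
    have h1 : P s * P s = P s := groundProj_mul_self S (H s)
    have h2 : P t * P t = P t := groundProj_mul_self S (H t)
    have h3 : ∀ x, P s * (P s * x) = P s * x := fun x => by rw [← mul_assoc, h1]
    simp only [mul_sub, sub_mul, mul_assoc, h1, h2, h3, one_mul, mul_one]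
    abel
  exact hsum.congr (fun t _ => heq t) (heq s)

theorem differentiableWithinAt_reducedResolvent (hs : s ∈ Icc (0 : ℝ) 1) :
    DifferentiableWithinAt ℝ (fun t => reducedResolvent S (H t)) (Icc 0 1) s := by
  have hP := hH.differentiableWithinAt_groundProj hs
  have hinv := (differentiableAt_inverse (𝕜 := ℝ) (isUnit_excitation_add (hH.isSelfAdjoint s hs)
    (hH.nontrivial s hs))).comp_differentiableWithinAt s
    (((hH.differentiableWithinAt_excitation hs).add hP).add_const (1 - S.starProjection))
  exact (hinv.sub hP).sub_const (1 - S.starProjection)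

end IsGappedFamily

end Perturbation

/-! ### Formal derivative identities for `p` and `r` -/

namespace IsReducedResolvent

variable {R : Type*} [Ring R] {k p a r p' a' r' : R}

theorem mul_deriv_mul_eq_zero {p p' : R} (pp : p * p = p) (h : p' * p + p * p' = p') :
    p * p' * p = 0 := by
  have h1 := congrArg (fun x => p * x * p) h
  have h2 : p * (p' * p) * p = p * p' * p := by rw [mul_assoc, mul_assoc, pp, mul_assoc]
  have h3 : p * (p * p') * p = p * p' * p := by rw [← mul_assoc, pp]
  simp only [mul_add, add_mul, h2, h3] at h1
  simpa using h1

variable (hr : IsReducedResolvent k p a r)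

include hr

theorem sub_mul_deriv (hap : a' * p + a * p' = 0) : (k - p) * p' = -(r * a' * p) := by
  have h := congrArg (fun x => r * x) hap
  simp only [mul_add, ← mul_assoc, hr.ra, mul_zero] at h
  exact eq_neg_of_add_eq_zero_right h

theorem deriv_mul_sub (hpa : p' * a + p * a' = 0) : p' * (k - p) = -(p * a' * r) := by
  have h := congrArg (fun x => x * r) hpa
  simp only [add_mul, mul_assoc, hr.ar, zero_mul] at h
  rw [mul_assoc]
  exact eq_neg_of_add_eq_zero_left h

theorem deriv_mul_proj (hpp : p' * p + p * p' = p') (hkp : k * p' = p')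
    (hap : a' * p + a * p' = 0) : p' * p = -(r * a' * p) := by
  have h := congrArg (fun x => x * p) (hr.sub_mul_deriv hap)
  simp only [sub_mul, hkp, neg_mul, mul_deriv_mul_eq_zero hr.pp hpp, sub_zero, mul_assoc,
    hr.pp] at h
  rw [h, mul_assoc]

theorem deriv_mul_resolvent (hpa : p' * a + p * a' = 0) : p' * r = -(p * a' * r * r) := by
  have h := congrArg (fun x => x * r) (hr.deriv_mul_sub hpa)
  simpa only [mul_assoc, sub_mul, hr.kr, hr.pr, sub_zero, neg_mul] using h

theorem resolvent_mul_deriv (hap : a' * p + a * p' = 0) : r * p' = -(r * r * a' * p) := by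
  have h := congrArg (fun x => r * x) (hr.sub_mul_deriv hap)
  simpa only [← mul_assoc, mul_sub, hr.rk, hr.rp, sub_zero, mul_neg] using h

/-- Multiplying the derivative of `r a = k - p` by `r` on the right gives `r' (k - p)`; the
derivative of `r p = 0` supplies the missing `r' p`. -/
theorem deriv_resolvent (hra : r' * a + r * a' = -p') (hrp : r' * p + r * p' = 0)
    (hrk : r' * k = r') : r' = -(r * a' * r) - p' * r - r * p' := by
  have h := congrArg (fun x => x * r) hra
  simp only [add_mul, mul_assoc, hr.ar, neg_mul, mul_sub, hrk] at h
  rw [← mul_assoc] at h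
  have h1 : r' * p = -(r * p') := eq_neg_of_add_eq_zero_left hrp
  rw [h1, sub_neg_eq_add] at h
  have h2 : r' = -(p' * r) - r * a' * r - r * p' := by rw [← h]; abel
  rw [h2]; abel

theorem mul_deriv_operator_mul (hap : a' * p + a * p' = 0) : p * a' * p = 0 := by
  have h := congrArg (fun x => p * x) hap
  simpa only [mul_add, ← mul_assoc, hr.pa, zero_mul, add_zero, mul_zero] using h

end IsReducedResolvent

/-! ### Derivatives of the ground data and their norms -/

section Derivatives

theorem eq_of_hasDerivWithinAt {F : Type*} [NormedAddCommGroup F] [NormedSpace ℝ F]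
    {f g : ℝ → F} {f' g' : F} {s : ℝ} (hs : s ∈ Icc (0 : ℝ) 1)
    (hf : HasDerivWithinAt f f' (Icc 0 1) s) (hg : HasDerivWithinAt g g' (Icc 0 1) s)
    (h : ∀ t ∈ Icc (0 : ℝ) 1, f t = g t) : f' = g' :=
  (uniqueDiffOn_Icc zero_lt_one s hs).eq_deriv _ (hf.congr (fun t ht => (h t ht).symm)
    (h s hs).symm) hg

variable {E : Type*} [NormedAddCommGroup E] [InnerProductSpace ℂ E] [FiniteDimensional ℂ E]

theorem isSelfAdjoint_dot {f : ℝ → E →L[ℂ] E} {s : ℝ} (hs : s ∈ Icc (0 : ℝ) 1)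
    (hf : DifferentiableWithinAt ℝ f (Icc 0 1) s) (h : ∀ t ∈ Icc (0 : ℝ) 1, IsSelfAdjoint (f t)) :
    IsSelfAdjoint (dot f s) :=
  eq_of_hasDerivWithinAt hs hf.hasDerivWithinAt.star hf.hasDerivWithinAt
    fun t ht => (h t ht).star_eq

namespace IsGappedFamily

variable {S : Submodule ℂ E} {H : ℝ → E →L[ℂ] E} (hH : IsGappedFamily S H) {s : ℝ}

include hH

theorem isReducedResolvent (hs : s ∈ Icc (0 : ℝ) 1) :
    IsReducedResolvent S.starProjection (groundProj S (H s)) (excitation S (H s))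
      (reducedResolvent S (H s)) :=
  LocalAdiabatic.isReducedResolvent (hH.isSelfAdjoint s hs) (hH.nontrivial s hs)

theorem localGap_pos (hs : s ∈ Icc (0 : ℝ) 1) : 0 < localGap S (H s) :=
  (localGap_spec (hH.isSelfAdjoint s hs) (hH.nontrivial s hs)).1

theorem norm_reducedResolvent_le (hs : s ∈ Icc (0 : ℝ) 1) :
    ‖reducedResolvent S (H s)‖ ≤ 1 / localGap S (H s) :=
  LocalAdiabatic.norm_reducedResolvent_le (hH.isSelfAdjoint s hs) (hH.nontrivial s hs)

theorem hasDerivWithinAt_block (hs : s ∈ Icc (0 : ℝ) 1) :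
    HasDerivWithinAt (fun t => block S (H t)) (dot (fun t => block S (H t)) s) (Icc 0 1) s :=
  (hH.differentiableOn s hs).hasDerivWithinAt

theorem hasDerivWithinAt_groundProj (hs : s ∈ Icc (0 : ℝ) 1) :
    HasDerivWithinAt (fun t => groundProj S (H t)) (dot (fun t => groundProj S (H t)) s)
      (Icc 0 1) s :=
  (hH.differentiableWithinAt_groundProj hs).hasDerivWithinAt

theorem hasDerivWithinAt_reducedResolvent (hs : s ∈ Icc (0 : ℝ) 1) :
    HasDerivWithinAt (fun t => reducedResolvent S (H t))
      (dot (fun t => reducedResolvent S (H t)) s) (Icc 0 1) s :=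
  (hH.differentiableWithinAt_reducedResolvent hs).hasDerivWithinAt

theorem hasDerivWithinAt_excitation (hs : s ∈ Icc (0 : ℝ) 1) :
    HasDerivWithinAt (fun t => excitation S (H t))
      (dot (fun t => block S (H t)) s
        - ((dot (fun t => groundEnergy S (H t)) s : ℝ) : ℂ) • S.starProjection) (Icc 0 1) s := by
  have h : HasDerivWithinAt (fun t => ((groundEnergy S (H t) : ℝ) : ℂ))
      ((dot (fun t => groundEnergy S (H t)) s : ℝ) : ℂ) (Icc 0 1) s :=
    Complex.ofRealCLM.hasFDerivAt.comp_hasDerivWithinAt s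
      (hH.differentiableWithinAt_groundEnergy hs).hasDerivWithinAt
  exact (hH.hasDerivWithinAt_block hs).sub (h.smul_const S.starProjection)

theorem dot_groundProj_mul_add (hs : s ∈ Icc (0 : ℝ) 1) :
    dot (fun t => groundProj S (H t)) s * groundProj S (H s)
      + groundProj S (H s) * dot (fun t => groundProj S (H t)) s
      = dot (fun t => groundProj S (H t)) s :=
  eq_of_hasDerivWithinAt hs
    ((hH.hasDerivWithinAt_groundProj hs).mul (hH.hasDerivWithinAt_groundProj hs))
    (hH.hasDerivWithinAt_groundProj hs) fun t _ => groundProj_mul_self S (H t)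

theorem groundProj_mul_dot_mul (hs : s ∈ Icc (0 : ℝ) 1) :
    groundProj S (H s) * dot (fun t => groundProj S (H t)) s * groundProj S (H s) = 0 :=
  IsReducedResolvent.mul_deriv_mul_eq_zero (groundProj_mul_self S (H s))
    (hH.dot_groundProj_mul_add hs)

theorem starProjection_mul_dot_groundProj (hs : s ∈ Icc (0 : ℝ) 1) :
    S.starProjection * dot (fun t => groundProj S (H t)) s
      = dot (fun t => groundProj S (H t)) s :=
  eq_of_hasDerivWithinAt hs ((hH.hasDerivWithinAt_groundProj hs).const_mul _)
    (hH.hasDerivWithinAt_groundProj hs) fun t _ => starProjection_mul_groundProj S (H t)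

theorem deriv_excitation_mul_groundProj (hs : s ∈ Icc (0 : ℝ) 1) :
    (dot (fun t => block S (H t)) s
        - ((dot (fun t => groundEnergy S (H t)) s : ℝ) : ℂ) • S.starProjection)
        * groundProj S (H s)
      + excitation S (H s) * dot (fun t => groundProj S (H t)) s = 0 := by
  have h := (hH.hasDerivWithinAt_excitation hs).mul (hH.hasDerivWithinAt_groundProj hs)
  exact eq_of_hasDerivWithinAt hs h (hasDerivWithinAt_const s _ (0 : E →L[ℂ] E))
    fun t _ => excitation_mul_groundProj S (H t)

theorem groundProj_mul_deriv_excitation (hs : s ∈ Icc (0 : ℝ) 1) :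
    dot (fun t => groundProj S (H t)) s * excitation S (H s)
      + groundProj S (H s) * (dot (fun t => block S (H t)) s
        - ((dot (fun t => groundEnergy S (H t)) s : ℝ) : ℂ) • S.starProjection) = 0 := by
  have h := (hH.hasDerivWithinAt_groundProj hs).mul (hH.hasDerivWithinAt_excitation hs)
  exact eq_of_hasDerivWithinAt hs h (hasDerivWithinAt_const s _ (0 : E →L[ℂ] E))
    fun t ht => groundProj_mul_excitation S (hH.isSelfAdjoint t ht)

/-- The derivative of the ground energy drops out because `r P = 0`. -/
theorem dot_groundProj_mul_groundProj (hs : s ∈ Icc (0 : ℝ) 1) :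
    dot (fun t => groundProj S (H t)) s * groundProj S (H s)
      = -(reducedResolvent S (H s) * dot (fun t => block S (H t)) s * groundProj S (H s)) := by
  have hr := hH.isReducedResolvent hs
  rw [hr.deriv_mul_proj (hH.dot_groundProj_mul_add hs) (hH.starProjection_mul_dot_groundProj hs)
    (hH.deriv_excitation_mul_groundProj hs), mul_sub, sub_mul, mul_smul_comm, hr.rk,
    smul_mul_assoc, hr.rp, smul_zero, sub_zero]

theorem dot_reducedResolvent_mul_starProjection (hs : s ∈ Icc (0 : ℝ) 1) :
    dot (fun t => reducedResolvent S (H t)) s * S.starProjection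
      = dot (fun t => reducedResolvent S (H t)) s :=
  eq_of_hasDerivWithinAt hs ((hH.hasDerivWithinAt_reducedResolvent hs).mul_const _)
    (hH.hasDerivWithinAt_reducedResolvent hs) fun _ ht => (hH.isReducedResolvent ht).rk

theorem starProjection_mul_dot_reducedResolvent (hs : s ∈ Icc (0 : ℝ) 1) :
    S.starProjection * dot (fun t => reducedResolvent S (H t)) s
      = dot (fun t => reducedResolvent S (H t)) s :=
  eq_of_hasDerivWithinAt hs ((hH.hasDerivWithinAt_reducedResolvent hs).const_mul _)
    (hH.hasDerivWithinAt_reducedResolvent hs) fun _ ht => (hH.isReducedResolvent ht).kr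

/-- Hellmann–Feynman: `P Ḣ_S P = μ̇ P`, and `‖P‖ = 1` since the ground space is nonzero. -/
theorem abs_dot_groundEnergy_le (hs : s ∈ Icc (0 : ℝ) 1) :
    |dot (fun t => groundEnergy S (H t)) s| ≤ normDot S H s := by
  have hr := hH.isReducedResolvent hs
  have h := hr.mul_deriv_operator_mul (hH.deriv_excitation_mul_groundProj hs)
  rw [mul_sub, sub_mul, sub_eq_zero, mul_smul_comm, hr.pk, smul_mul_assoc, hr.pp] at h
  have hnorm : ‖groundProj S (H s)‖ = 1 := Submodule.norm_starProjection _
    (groundSpace_ne_bot (hH.isSelfAdjoint s hs) (hH.nontrivial s hs).nonempty)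
  have h2 := congrArg norm h
  rw [norm_smul, hnorm, mul_one, Complex.norm_real, Real.norm_eq_abs] at h2
  rw [← h2]
  refine (norm_mul_le _ _).trans ?_
  rw [hnorm, mul_one]
  refine (norm_mul_le _ _).trans ?_
  rw [hnorm, one_mul, normDot]

theorem dot_reducedResolvent_eq (hs : s ∈ Icc (0 : ℝ) 1) :
    dot (fun t => reducedResolvent S (H t)) s
      = -(reducedResolvent S (H s) * dot (fun t => block S (H t)) s * reducedResolvent S (H s))
        + ((dot (fun t => groundEnergy S (H t)) s : ℝ) : ℂ) •
          (reducedResolvent S (H s) * reducedResolvent S (H s))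
        + groundProj S (H s) * dot (fun t => block S (H t)) s * reducedResolvent S (H s)
          * reducedResolvent S (H s)
        + reducedResolvent S (H s) * reducedResolvent S (H s) * dot (fun t => block S (H t)) s
          * groundProj S (H s) := by
  have hr := hH.isReducedResolvent hs
  have hra := eq_of_hasDerivWithinAt hs
    ((hH.hasDerivWithinAt_reducedResolvent hs).mul (hH.hasDerivWithinAt_excitation hs))
    ((hH.hasDerivWithinAt_groundProj hs).const_sub S.starProjection)
    fun _ ht => (hH.isReducedResolvent ht).ra
  have hrp := eq_of_hasDerivWithinAt hs
    ((hH.hasDerivWithinAt_reducedResolvent hs).mul (hH.hasDerivWithinAt_groundProj hs))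
    (hasDerivWithinAt_const s _ (0 : E →L[ℂ] E)) fun _ ht => (hH.isReducedResolvent ht).rp
  have h := hr.deriv_resolvent hra hrp (hH.dot_reducedResolvent_mul_starProjection hs)
  rw [hr.deriv_mul_resolvent (hH.groundProj_mul_deriv_excitation hs),
    hr.resolvent_mul_deriv (hH.deriv_excitation_mul_groundProj hs)] at h
  rw [h]
  simp only [mul_sub, sub_mul, mul_smul_comm, smul_mul_assoc, hr.rk, hr.pk, hr.rp, hr.pr,
    mul_zero, smul_zero, sub_zero, mul_assoc]
  abel

/-- The 4 counts the terms of `dot_reducedResolvent_eq`, each at most `‖Ḣ_S‖ / Γ_S²`. -/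
theorem norm_dot_reducedResolvent_le (hs : s ∈ Icc (0 : ℝ) 1) :
    ‖dot (fun t => reducedResolvent S (H t)) s‖
      ≤ 4 * (normDot S H s / localGap S (H s) ^ 2) := by
  rw [hH.dot_reducedResolvent_eq hs]
  set r := reducedResolvent S (H s)
  set h := dot (fun t => block S (H t)) s
  set p := groundProj S (H s)
  have hr : ‖r‖ ≤ 1 / localGap S (H s) := hH.norm_reducedResolvent_le hs
  have hp : ‖p‖ ≤ 1 := norm_groundProj_le S (H s)
  have hm := hH.abs_dot_groundEnergy_le hs
  have hpos := hH.localGap_pos hs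
  have hn : normDot S H s = ‖h‖ := rfl
  rw [hn] at hm ⊢
  set g := 1 / localGap S (H s) with hg
  have hg0 : 0 ≤ g := by positivity
  have e : ‖h‖ / localGap S (H s) ^ 2 = g * ‖h‖ * g := by rw [hg]; field_simp
  rw [e]
  have b1 : ‖r * h * r‖ ≤ g * ‖h‖ * g := (norm_mul₃_le).trans (by gcongr)
  have b2 : ‖((dot (fun t => groundEnergy S (H t)) s : ℝ) : ℂ) • (r * r)‖ ≤ g * ‖h‖ * g := by
    rw [norm_smul, Complex.norm_real, Real.norm_eq_abs]
    calc _ ≤ ‖h‖ * (g * g) := by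
          gcongr
          exact (norm_mul_le _ _).trans (by gcongr)
      _ = _ := by ring
  have b3 : ‖p * h * r * r‖ ≤ g * ‖h‖ * g := by
    calc _ ≤ ‖p‖ * ‖h‖ * ‖r‖ * ‖r‖ :=
          (norm_mul_le _ _).trans (by gcongr; exact norm_mul₃_le)
      _ ≤ 1 * ‖h‖ * g * g := by gcongr
      _ = _ := by ring
  have b4 : ‖r * r * h * p‖ ≤ g * ‖h‖ * g := by
    calc _ ≤ ‖r‖ * ‖r‖ * ‖h‖ * ‖p‖ :=
          (norm_mul_le _ _).trans (by gcongr; exact norm_mul₃_le)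
      _ ≤ g * g * ‖h‖ * 1 := by gcongr
      _ = _ := by ring
  refine (norm_add₄_le).trans ?_
  rw [norm_neg]
  linarith

end IsGappedFamily

end Derivatives

/-! ### The correction operator `Y` and its bounds -/

section Correction

variable {E : Type*} [NormedAddCommGroup E] [InnerProductSpace ℂ E] [FiniteDimensional ℂ E]

theorem mul_eq_zero_of_starProjection {S : Submodule ℂ E} {A B : E →L[ℂ] E}
    (hA : A * S.starProjection = A) (hB : Sᗮ.starProjection * B = B) : A * B = 0 := by
  rw [← hA, ← hB, Submodule.starProjection_orthogonal', mul_assoc, ← mul_assoc _ _ B, mul_sub,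
    mul_one, starProjection_mul_self, sub_self, zero_mul, mul_zero]

theorem mul_eq_zero_of_starProjection' {S : Submodule ℂ E} {A B : E →L[ℂ] E}
    (hA : A * Sᗮ.starProjection = A) (hB : S.starProjection * B = B) : A * B = 0 :=
  mul_eq_zero_of_starProjection hA (by simpa using hB)

/-- The norm of a block-diagonal operator is at most the larger of the norms of its blocks. -/
theorem norm_add_le_max_of_blocks {S : Submodule ℂ E} {A B : E →L[ℂ] E}
    (hA : S.starProjection * A = A) (hA' : A * S.starProjection = A)
    (hB : Sᗮ.starProjection * B = B) (hB' : B * Sᗮ.starProjection = B) :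
    ‖A + B‖ ≤ max ‖A‖ ‖B‖ := by
  have hM : 0 ≤ max ‖A‖ ‖B‖ := (norm_nonneg A).trans (le_max_left _ _)
  refine ContinuousLinearMap.opNorm_le_bound _ hM fun v => ?_
  have h1 : S.starProjection ((A + B) v) = A (S.starProjection v) := by
    have : S.starProjection * (A + B) = A * S.starProjection := by
      rw [mul_add, hA, hA', mul_eq_zero_of_starProjection (starProjection_mul_self S) hB, add_zero]
    exact congrArg (fun f : E →L[ℂ] E => f v) this
  have h2 : Sᗮ.starProjection ((A + B) v) = B (Sᗮ.starProjection v) := by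
    have : Sᗮ.starProjection * (A + B) = B * Sᗮ.starProjection := by
      rw [mul_add, hB, hB', mul_eq_zero_of_starProjection' (starProjection_mul_self Sᗮ) hA,
        zero_add]
    exact congrArg (fun f : E →L[ℂ] E => f v) this
  have h3 := Submodule.norm_sq_eq_add_norm_sq_starProjection ((A + B) v) S
  have h4 := Submodule.norm_sq_eq_add_norm_sq_starProjection v S
  rw [h1, h2] at h3
  have h5 : ‖A (S.starProjection v)‖ ≤ max ‖A‖ ‖B‖ * ‖S.starProjection v‖ :=
    A.le_of_opNorm_le (le_max_left _ _) _
  have h6 : ‖B (Sᗮ.starProjection v)‖ ≤ max ‖A‖ ‖B‖ * ‖Sᗮ.starProjection v‖ :=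
    B.le_of_opNorm_le (le_max_right _ _) _
  refine le_of_sq_le_sq ?_ (by positivity)
  rw [h3, mul_pow, h4, mul_add, ← mul_pow, ← mul_pow]
  gcongr

/-- The reduced resolvent of the block-diagonal operator `H'` at its ground energy. -/
noncomputable def totalResolvent (S : Submodule ℂ E) (A : E →L[ℂ] E) : E →L[ℂ] E :=
  reducedResolvent S A + reducedResolvent Sᗮ A

theorem one_div_minGap {S : Submodule ℂ E} {A : E →L[ℂ] E} (h : 0 < localGap S A)
    (h' : 0 < localGap Sᗮ A) :
    1 / minGap S A = max (1 / localGap S A) (1 / localGap Sᗮ A) := by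
  rw [minGap]
  rcases le_total (localGap S A) (localGap Sᗮ A) with hle | hle
  · rw [min_eq_left hle, max_eq_left (one_div_le_one_div_of_le h hle)]
  · rw [min_eq_right hle, max_eq_right (one_div_le_one_div_of_le h' hle)]

section Perp

variable (S : Submodule ℂ E) (A D : E →L[ℂ] E)

theorem groundProj_mul_groundProj_orthogonal : groundProj S A * groundProj Sᗮ A = 0 :=
  mul_eq_zero_of_starProjection (groundProj_mul_starProjection S A)
    (starProjection_mul_groundProj Sᗮ A)

theorem groundProj_orthogonal_mul_groundProj : groundProj Sᗮ A * groundProj S A = 0 :=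
  mul_eq_zero_of_starProjection' (groundProj_mul_starProjection Sᗮ A)
    (starProjection_mul_groundProj S A)

theorem one_sub_sub_mul_perpPart :
    (1 - groundProj S A - groundProj Sᗮ A) * perpPart S A D = perpPart S A D := by
  have h : (1 - groundProj S A - groundProj Sᗮ A) * (1 - groundProj S A - groundProj Sᗮ A)
      = 1 - groundProj S A - groundProj Sᗮ A := by
    simp [mul_sub, sub_mul, groundProj_mul_self, groundProj_mul_groundProj_orthogonal,
      groundProj_orthogonal_mul_groundProj]
  simp only [perpPart, ← mul_assoc, h]

theorem perpPart_mul_groundProj : perpPart S A D * groundProj S A = 0 := by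
  have h : (1 - groundProj S A - groundProj Sᗮ A) * groundProj S A = 0 := by
    simp [sub_mul, groundProj_mul_self, groundProj_orthogonal_mul_groundProj]
  rw [perpPart, mul_assoc, h, mul_zero]

variable {D} in
theorem isSelfAdjoint_perpPart (hD : IsSelfAdjoint D) : IsSelfAdjoint (perpPart S A D) := by
  have h : star (1 - groundProj S A - groundProj Sᗮ A) = 1 - groundProj S A - groundProj Sᗮ A := by
    rw [star_sub, star_sub, star_one, (isSelfAdjoint_groundProj S A).star_eq,
      (isSelfAdjoint_groundProj Sᗮ A).star_eq]
  rw [isSelfAdjoint_iff, perpPart, star_mul, star_mul, h, hD.star_eq, mul_assoc]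

variable {A} in
theorem block_add_block (hA : Commute A S.starProjection) : block S A + block Sᗮ A = A := by
  have h : S.starProjection * A = A * S.starProjection := hA.eq.symm
  rw [block, block, Submodule.starProjection_orthogonal']
  simp only [sub_mul, mul_sub, one_mul, mul_one, mul_assoc, h, starProjection_mul_self]
  abel

variable {A} in
-- The purpose of the shift: `H' - μ` becomes the sum of the two excitations, so a single resolvent
-- `R` serves both blocks.
theorem shifted_eq (hA : Commute A S.starProjection) :
    shifted S A = ((groundEnergy S A : ℝ) : ℂ) • (1 : E →L[ℂ] E)
      + (excitation S A + excitation Sᗮ A) := by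
  have h1 : (1 : E →L[ℂ] E) = S.starProjection + Sᗮ.starProjection := by
    rw [Submodule.starProjection_orthogonal']; abel
  rw [shifted, excitation, excitation]
  nth_rewrite 1 [← block_add_block S hA]
  rw [h1]
  push_cast
  module

end Perp

section Static

variable {S : Submodule ℂ E} {A D : E →L[ℂ] E}

theorem norm_totalResolvent_le
    (hr : IsReducedResolvent S.starProjection (groundProj S A) (excitation S A)
      (reducedResolvent S A))
    (hr' : IsReducedResolvent Sᗮ.starProjection (groundProj Sᗮ A) (excitation Sᗮ A)
      (reducedResolvent Sᗮ A))
    (h : 0 < localGap S A) (h' : 0 < localGap Sᗮ A)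
    (hn : ‖reducedResolvent S A‖ ≤ 1 / localGap S A)
    (hn' : ‖reducedResolvent Sᗮ A‖ ≤ 1 / localGap Sᗮ A) :
    ‖totalResolvent S A‖ ≤ 1 / minGap S A := by
  rw [one_div_minGap h h']
  exact (norm_add_le_max_of_blocks hr.kr hr.rk hr'.kr hr'.rk).trans (max_le_max hn hn')

theorem excitation_add_mul_totalResolvent
    (hr : IsReducedResolvent S.starProjection (groundProj S A) (excitation S A)
      (reducedResolvent S A))
    (hr' : IsReducedResolvent Sᗮ.starProjection (groundProj Sᗮ A) (excitation Sᗮ A)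
      (reducedResolvent Sᗮ A)) :
    (excitation S A + excitation Sᗮ A) * totalResolvent S A
      = 1 - groundProj S A - groundProj Sᗮ A := by
  rw [totalResolvent, add_mul, mul_add, mul_add, hr.ar, hr'.ar,
    mul_eq_zero_of_starProjection hr.ak hr'.kr, mul_eq_zero_of_starProjection' hr'.ak hr.kr,
    Submodule.starProjection_orthogonal']
  abel

theorem norm_mul_perpPart_le {R : E →L[ℂ] E} (hR : ‖R‖ ≤ 1 / minGap S A) :
    ‖R * perpPart S A D‖ ≤ 1 - eta S A D := by
  refine (norm_mul_le _ _).trans ?_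
  rw [eta, sub_sub_cancel, div_eq_mul_one_div, mul_comm]
  gcongr

theorem isUnit_one_add {X : E →L[ℂ] E} {ε : ℝ} (hε : 0 < ε) (hX : ‖X‖ ≤ 1 - ε) :
    IsUnit (1 + X) := by
  have : 1 + X = 1 - (-X) := by rw [sub_neg_eq_add]
  rw [this]
  exact isUnit_one_sub_of_norm_lt_one (by rw [norm_neg]; linarith)

/-- From `Y = Z - X Y`, the term `(1 - ε) ‖Y‖` is absorbed on the left. With `X = R Δ^⊥` and `ε = η`
this is the source of every `1/η`. -/
theorem norm_le_of_one_add_mul_eq {X Y Z : E →L[ℂ] E} {ε : ℝ} (hε : 0 < ε) (hX : ‖X‖ ≤ 1 - ε)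
    (h : (1 + X) * Y = Z) : ‖Y‖ ≤ 1 / ε * ‖Z‖ := by
  have h1 : Y = Z - X * Y := by rw [← h, add_mul, one_mul, add_sub_cancel_right]
  have h2 : ‖Y‖ ≤ ‖Z‖ + (1 - ε) * ‖Y‖ := by
    calc ‖Y‖ = ‖Z - X * Y‖ := by rw [← h1]
      _ ≤ ‖Z‖ + ‖X * Y‖ := norm_sub_le _ _
      _ ≤ ‖Z‖ + (1 - ε) * ‖Y‖ := by
          gcongr
          exact (norm_mul_le _ _).trans (by gcongr)
  rw [one_div, inv_mul_eq_div, le_div_iff₀ hε]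
  linarith

end Static

/-- The solution of `[H' + Δ^⊥, Y] P_μ = Ṗ_μ P_μ` for the unperturbed operator. -/
noncomputable def freeCorrection (S : Submodule ℂ E) (H : ℝ → E →L[ℂ] E) (s : ℝ) : E →L[ℂ] E :=
  -(reducedResolvent S (H s) * reducedResolvent S (H s) * dot (fun t => block S (H t)) s
    * groundProj S (H s))

/-- The solution `Y` of `[H' + Δ^⊥, Y] P_μ = Ṗ_μ P_μ`. -/
noncomputable def correction (S : Submodule ℂ E) (H Δ : ℝ → E →L[ℂ] E) (s : ℝ) : E →L[ℂ] E :=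
  Ring.inverse (1 + totalResolvent S (H s) * perpPart S (H s) (Δ s)) * freeCorrection S H s

theorem freeCorrection_mul_groundProj (S : Submodule ℂ E) (H : ℝ → E →L[ℂ] E) (s : ℝ) :
    freeCorrection S H s * groundProj S (H s) = freeCorrection S H s := by
  rw [freeCorrection, neg_mul, mul_assoc _ _ (groundProj S (H s)), groundProj_mul_self]

theorem correction_mul_groundProj (S : Submodule ℂ E) (H Δ : ℝ → E →L[ℂ] E) (s : ℝ) :
    correction S H Δ s * groundProj S (H s) = correction S H Δ s := by
  rw [correction, mul_assoc, freeCorrection_mul_groundProj]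

namespace IsGappedFamily

variable {S : Submodule ℂ E} {H Δ : ℝ → E →L[ℂ] E} {s : ℝ}

theorem norm_freeCorrection_le (hS : IsGappedFamily S H) (hs : s ∈ Icc (0 : ℝ) 1) :
    ‖freeCorrection S H s‖ ≤ normDot S H s / localGap S (H s) ^ 2 := by
  have hr := hS.norm_reducedResolvent_le hs
  have hp := norm_groundProj_le S (H s)
  have hpos := hS.localGap_pos hs
  rw [freeCorrection, norm_neg, normDot]
  set g := 1 / localGap S (H s) with hg
  have hg0 : 0 ≤ g := by positivity
  calc _ ≤ ‖reducedResolvent S (H s)‖ * ‖reducedResolvent S (H s)‖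
        * ‖dot (fun t => block S (H t)) s‖ * ‖groundProj S (H s)‖ :=
        (norm_mul_le _ _).trans (by gcongr; exact norm_mul₃_le)
    _ ≤ g * g * ‖dot (fun t => block S (H t)) s‖ * 1 := by gcongr
    _ = _ := by rw [hg]; field_simp

theorem hasDerivWithinAt_freeCorrection (hS : IsGappedFamily S H)
    (h2 : DifferentiableOn ℝ (dot fun t => block S (H t)) (Icc 0 1)) (hs : s ∈ Icc (0 : ℝ) 1) :
    HasDerivWithinAt (freeCorrection S H)
      (-((((dot (fun t => reducedResolvent S (H t)) s * reducedResolvent S (H s)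
          + reducedResolvent S (H s) * dot (fun t => reducedResolvent S (H t)) s)
          * dot (fun t => block S (H t)) s
        + reducedResolvent S (H s) * reducedResolvent S (H s)
          * dot (dot fun t => block S (H t)) s) * groundProj S (H s)
        + reducedResolvent S (H s) * reducedResolvent S (H s)
          * dot (fun t => block S (H t)) s * dot (fun t => groundProj S (H t)) s)))
      (Icc 0 1) s := by
  have hr := hS.hasDerivWithinAt_reducedResolvent hs
  have hrr := hr.mul hr
  have hh : HasDerivWithinAt (dot fun t => block S (H t)) (dot (dot fun t => block S (H t)) s)
    (Icc 0 1) s := (h2 s hs).hasDerivWithinAt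
  have hrrh := hrr.mul hh
  exact (hrrh.mul (hS.hasDerivWithinAt_groundProj hs)).neg

/-- Multiplication by `P` allows `Ṗ P = -r Ḣ_S P`. The two factors `r` contribute 4 each when
differentiated and `Ṗ` contributes 1, so 9 suffices for the stated 10. -/
theorem norm_dot_freeCorrection_mul_le (hS : IsGappedFamily S H)
    (h2 : DifferentiableOn ℝ (dot fun t => block S (H t)) (Icc 0 1)) (hs : s ∈ Icc (0 : ℝ) 1) :
    ‖dot (freeCorrection S H) s * groundProj S (H s)‖
      ≤ ‖dot (dot fun t => block S (H t)) s‖ / localGap S (H s) ^ 2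
        + 10 * (‖dot (fun t => block S (H t)) s ^ 2‖ / localGap S (H s) ^ 3) := by
  have hd : dot (freeCorrection S H) s = _ :=
    (hS.hasDerivWithinAt_freeCorrection h2 hs).derivWithin (uniqueDiffOn_Icc zero_lt_one s hs)
  have hsa : IsSelfAdjoint (dot (fun t => block S (H t)) s) :=
    isSelfAdjoint_dot hs (hS.differentiableOn s hs)
      fun t ht => block_isSelfAdjoint S (hS.isSelfAdjoint t ht)
  have hsq : ‖dot (fun t => block S (H t)) s ^ 2‖ = ‖dot (fun t => block S (H t)) s‖ ^ 2 := by
    rw [sq, sq, hsa.norm_mul_self, sq]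
  have hpp := hS.dot_groundProj_mul_groundProj hs
  have hr := hS.norm_reducedResolvent_le hs
  have hr' := hS.norm_dot_reducedResolvent_le hs
  have hp := norm_groundProj_le S (H s)
  have hpos := hS.localGap_pos hs
  rw [normDot] at hr'
  rw [hd, hsq, neg_mul, norm_neg, add_mul, mul_assoc _ (groundProj S (H s)), groundProj_mul_self,
    mul_assoc _ (dot (fun t => groundProj S (H t)) s), hpp]
  set r := reducedResolvent S (H s)
  set r' := dot (fun t => reducedResolvent S (H t)) s
  set h := dot (fun t => block S (H t)) s
  set h' := dot (dot fun t => block S (H t)) s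
  set p := groundProj S (H s)
  set g := 1 / localGap S (H s) with hg
  have hg0 : 0 ≤ g := by positivity
  have e1 : ‖h'‖ / localGap S (H s) ^ 2 = g * g * ‖h'‖ := by rw [hg]; field_simp
  have e2 : ‖h‖ ^ 2 / localGap S (H s) ^ 3 = g * g * g * ‖h‖ ^ 2 := by rw [hg]; field_simp
  have e3 : 4 * (‖h‖ / localGap S (H s) ^ 2) = 4 * (g * g * ‖h‖) := by rw [hg]; field_simp
  rw [e3] at hr'
  rw [e1, e2]
  have b1 : ‖(r' * r + r * r') * h‖ ≤ 8 * (g * g * g * ‖h‖ ^ 2) := by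
    calc _ ≤ (‖r'‖ * ‖r‖ + ‖r‖ * ‖r'‖) * ‖h‖ := by
          refine (norm_mul_le _ _).trans ?_
          gcongr
          exact (norm_add_le _ _).trans (add_le_add (norm_mul_le _ _) (norm_mul_le _ _))
      _ ≤ (4 * (g * g * ‖h‖) * g + g * (4 * (g * g * ‖h‖))) * ‖h‖ := by gcongr
      _ = _ := by ring
  have b2 : ‖r * r * h'‖ ≤ g * g * ‖h'‖ := norm_mul₃_le.trans (by gcongr)
  have b3 : ‖r * r * h * -(r * h * p)‖ ≤ g * g * g * ‖h‖ ^ 2 := by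
    calc _ ≤ ‖r‖ * ‖r‖ * ‖h‖ * (‖r‖ * ‖h‖ * ‖p‖) := by
          refine (norm_mul_le _ _).trans ?_
          rw [norm_neg]
          exact mul_le_mul norm_mul₃_le norm_mul₃_le (norm_nonneg _) (by positivity)
      _ ≤ g * g * ‖h‖ * (g * ‖h‖ * 1) := by gcongr
      _ = _ := by ring
  have b4 : ‖((r' * r + r * r') * h + r * r * h') * p‖
      ≤ 8 * (g * g * g * ‖h‖ ^ 2) + g * g * ‖h'‖ := by
    calc _ ≤ ‖(r' * r + r * r') * h + r * r * h'‖ * 1 :=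
          (norm_mul_le _ _).trans (by gcongr)
      _ ≤ _ := by
          rw [mul_one]
          exact (norm_add_le _ _).trans (add_le_add b1 b2)
  have hnn : 0 ≤ g * g * g * ‖h‖ ^ 2 := by positivity
  linarith [norm_add_le (((r' * r + r * r') * h + r * r * h') * p) (r * r * h * -(r * h * p))]

variable (hS : IsGappedFamily S H) (hS' : IsGappedFamily Sᗮ H)

include hS hS'

theorem norm_totalResolvent_le (hs : s ∈ Icc (0 : ℝ) 1) :
    ‖totalResolvent S (H s)‖ ≤ 1 / minGap S (H s) :=
  LocalAdiabatic.norm_totalResolvent_le (hS.isReducedResolvent hs) (hS'.isReducedResolvent hs)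
    (hS.localGap_pos hs) (hS'.localGap_pos hs) (hS.norm_reducedResolvent_le hs)
    (hS'.norm_reducedResolvent_le hs)

theorem one_add_mul_correction (hs : s ∈ Icc (0 : ℝ) 1) (hη : 0 < eta S (H s) (Δ s)) :
    (1 + totalResolvent S (H s) * perpPart S (H s) (Δ s)) * correction S H Δ s
      = freeCorrection S H s := by
  rw [correction, ← mul_assoc, Ring.mul_inverse_cancel _ (isUnit_one_add hη
    (norm_mul_perpPart_le (hS.norm_totalResolvent_le hS' hs))), one_mul]

theorem norm_correction_le (hs : s ∈ Icc (0 : ℝ) 1) (hη : 0 < eta S (H s) (Δ s)) :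
    ‖correction S H Δ s‖
      ≤ 1 / eta S (H s) (Δ s) * (normDot S H s / localGap S (H s) ^ 2) := by
  refine (norm_le_of_one_add_mul_eq hη
    (norm_mul_perpPart_le (hS.norm_totalResolvent_le hS' hs))
    (hS.one_add_mul_correction hS' hs hη)).trans ?_
  gcongr
  exact hS.norm_freeCorrection_le hs

/-- Apply `H' - μ` to `(1 + R Δ^⊥) Y = y`: on the left `(H' - μ) R` fixes `Δ^⊥`, on the right `(H' -
μ) y = -r Ḣ_S P = Ṗ P`. -/
theorem shifted_add_perpPart_mul_correction (hs : s ∈ Icc (0 : ℝ) 1)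
    (hη : 0 < eta S (H s) (Δ s)) (hcomm : Commute (H s) S.starProjection) :
    (shifted S (H s) + perpPart S (H s) (Δ s)) * correction S H Δ s
      = ((groundEnergy S (H s) : ℝ) : ℂ) • correction S H Δ s
        + dot (fun t => groundProj S (H t)) s * groundProj S (H s) := by
  have hr := hS.isReducedResolvent hs
  have hr' := hS'.isReducedResolvent hs
  have h1 := congrArg (fun x => (excitation S (H s) + excitation Sᗮ (H s)) * x)
    (hS.one_add_mul_correction hS' hs hη)
  have h2 : (excitation S (H s) + excitation Sᗮ (H s)) * freeCorrection S H s
      = dot (fun t => groundProj S (H t)) s * groundProj S (H s) := by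
    have h3 : (excitation S (H s) + excitation Sᗮ (H s)) * reducedResolvent S (H s)
        = S.starProjection - groundProj S (H s) := by
      rw [add_mul, hr.ar, mul_eq_zero_of_starProjection' hr'.ak hr.kr, add_zero]
    rw [freeCorrection, hS.dot_groundProj_mul_groundProj hs]
    simp only [mul_neg, ← mul_assoc, h3]
    rw [sub_mul, hr.kr, hr.pr, sub_zero]
  simp only [add_mul, one_mul] at h1
  rw [← add_mul, ← add_mul, h2, mul_add, mul_assoc (totalResolvent S (H s)), ← mul_assoc,
    excitation_add_mul_totalResolvent hr hr', ← mul_assoc, one_sub_sub_mul_perpPart] at h1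
  rw [shifted_eq S hcomm, ← h1, add_mul, add_mul, smul_mul_assoc, one_mul]
  abel

theorem differentiableWithinAt_perpPart (hΔ : DifferentiableOn ℝ Δ (Icc 0 1))
    (hs : s ∈ Icc (0 : ℝ) 1) :
    DifferentiableWithinAt ℝ (fun t => perpPart S (H t) (Δ t)) (Icc 0 1) s := by
  have hq := ((hS.differentiableWithinAt_groundProj hs).const_sub 1).sub
    (hS'.differentiableWithinAt_groundProj hs)
  exact (hq.mul (hΔ s hs)).mul hq

theorem differentiableWithinAt_correction (hΔ : DifferentiableOn ℝ Δ (Icc 0 1))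
    (h2 : DifferentiableOn ℝ (dot fun t => block S (H t)) (Icc 0 1)) (hs : s ∈ Icc (0 : ℝ) 1)
    (hη : 0 < eta S (H s) (Δ s)) :
    DifferentiableWithinAt ℝ (correction S H Δ) (Icc 0 1) s := by
  have hR := (hS.differentiableWithinAt_reducedResolvent hs).add
    (hS'.differentiableWithinAt_reducedResolvent hs)
  have hX := (hR.mul (hS.differentiableWithinAt_perpPart hS' hΔ hs)).const_add 1
  have hinv := (differentiableAt_inverse (𝕜 := ℝ) (isUnit_one_add hη
    (norm_mul_perpPart_le (hS.norm_totalResolvent_le hS' hs)))).comp_differentiableWithinAt s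
    hX
  exact hinv.mul (hS.hasDerivWithinAt_freeCorrection h2 hs).differentiableWithinAt

theorem hasDerivWithinAt_totalResolvent (hs : s ∈ Icc (0 : ℝ) 1) :
    HasDerivWithinAt (fun t => totalResolvent S (H t))
      (dot (fun t => reducedResolvent S (H t)) s + dot (fun t => reducedResolvent Sᗮ (H t)) s)
      (Icc 0 1) s :=
  (hS.hasDerivWithinAt_reducedResolvent hs).add (hS'.hasDerivWithinAt_reducedResolvent hs)

/-- The two derivatives live in complementary blocks, hence a maximum and not a sum. The second
entry is weaker than the bound `‖Ḣ_S̄‖ / Γ_S̄²` available for that block. -/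
theorem norm_dot_totalResolvent_le (hs : s ∈ Icc (0 : ℝ) 1) :
    ‖dot (fun t => reducedResolvent S (H t)) s + dot (fun t => reducedResolvent Sᗮ (H t)) s‖
      ≤ 4 * max (normDot S H s / localGap S (H s) ^ 2)
          ((2 * normDot Sᗮ H s + normDot S H s) / localGap Sᗮ (H s) ^ 2) := by
  refine (norm_add_le_max_of_blocks (hS.starProjection_mul_dot_reducedResolvent hs)
    (hS.dot_reducedResolvent_mul_starProjection hs)
    (hS'.starProjection_mul_dot_reducedResolvent hs)
    (hS'.dot_reducedResolvent_mul_starProjection hs)).trans ?_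
  rw [mul_max_of_nonneg _ _ (by norm_num : (0 : ℝ) ≤ 4)]
  refine max_le_max (hS.norm_dot_reducedResolvent_le hs)
    ((hS'.norm_dot_reducedResolvent_le hs).trans ?_)
  have h1 : 0 ≤ normDot S H s := norm_nonneg _
  have h2 : 0 ≤ normDot Sᗮ H s := norm_nonneg _
  gcongr
  linarith

theorem norm_dot_correction_mul_le (hΔ : DifferentiableOn ℝ Δ (Icc 0 1))
    (h2 : DifferentiableOn ℝ (dot fun t => block S (H t)) (Icc 0 1)) (hs : s ∈ Icc (0 : ℝ) 1)
    (hη : ∀ t ∈ Icc (0 : ℝ) 1, 0 < eta S (H t) (Δ t)) :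
    ‖dot (correction S H Δ) s * groundProj S (H s)‖
      ≤ 1 / eta S (H s) (Δ s) * bulkConst S H Δ s := by
  have hY : HasDerivWithinAt (correction S H Δ) (dot (correction S H Δ) s) (Icc 0 1) s :=
    (hS.differentiableWithinAt_correction hS' hΔ h2 hs (hη s hs)).hasDerivWithinAt
  have hD : HasDerivWithinAt (fun t => perpPart S (H t) (Δ t))
      (dot (fun t => perpPart S (H t) (Δ t)) s) (Icc 0 1) s :=
    (hS.differentiableWithinAt_perpPart hS' hΔ hs).hasDerivWithinAt
  have hy : HasDerivWithinAt (freeCorrection S H) (dot (freeCorrection S H) s) (Icc 0 1) s :=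
    (hS.hasDerivWithinAt_freeCorrection h2 hs).differentiableWithinAt.hasDerivWithinAt
  have hRD := (hS.hasDerivWithinAt_totalResolvent hS' hs).mul hD
  have hprod := (hRD.const_add 1).mul hY
  have hder := eq_of_hasDerivWithinAt hs hprod hy
    fun t ht => hS.one_add_mul_correction hS' ht (hη t ht)
  have hR := hS.norm_totalResolvent_le hS' hs
  have hR' := hS.norm_dot_totalResolvent_le hS' hs
  have hYn := hS.norm_correction_le hS' hs (hη s hs)
  have hyn := hS.norm_dot_freeCorrection_mul_le h2 hs
  set R := totalResolvent S (H s)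
  set R' := dot (fun t => reducedResolvent S (H t)) s + dot (fun t => reducedResolvent Sᗮ (H t)) s
  set D := perpPart S (H s) (Δ s)
  set D' := dot (fun t => perpPart S (H t) (Δ t)) s
  set Y := correction S H Δ s
  -- The defining equation of `Y`, differentiated and multiplied by `P`. The factor `Y` on the right
  -- carries its own `1/η`, which is the one inside `bulkConst`.
  have hsolve : (1 + R * D) * (dot (correction S H Δ) s * groundProj S (H s))
      = dot (freeCorrection S H) s * groundProj S (H s) - (R' * D + R * D') * Y := by
    have hder' : (R' * D + R * D') * Y + (1 + R * D) * dot (correction S H Δ) s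
        = dot (freeCorrection S H) s := hder
    have hYp : Y * groundProj S (H s) = Y := correction_mul_groundProj S H Δ s
    rw [← hder', add_mul (_ * Y), mul_assoc _ Y, hYp, mul_assoc (1 + R * D), add_sub_cancel_left]
  refine (norm_le_of_one_add_mul_eq (hη s hs) (norm_mul_perpPart_le hR) hsolve).trans ?_
  have hη0 := hη s hs
  rw [bulkConst]
  gcongr
  refine (norm_sub_le _ _).trans (add_le_add hyn ?_)
  set M := max (normDot S H s / localGap S (H s) ^ 2)
    ((2 * normDot Sᗮ H s + normDot S H s) / localGap Sᗮ (H s) ^ 2)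
  calc _ ≤ (‖R'‖ * ‖D‖ + ‖R‖ * ‖D'‖) * ‖Y‖ := by
        refine (norm_mul_le _ _).trans ?_
        gcongr
        exact (norm_add_le _ _).trans (add_le_add (norm_mul_le _ _) (norm_mul_le _ _))
    _ ≤ (4 * M * ‖D‖ + 1 / minGap S (H s) * ‖D'‖)
        * (1 / eta S (H s) (Δ s) * (normDot S H s / localGap S (H s) ^ 2)) := by
        have h4 : 0 ≤ 4 * M := (norm_nonneg _).trans hR'
        have h5 : 0 ≤ 1 / minGap S (H s) := (norm_nonneg _).trans hR
        gcongr
    _ = _ := by ring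

end IsGappedFamily

end Correction

/-! ### Unitary evolutions and their comparison -/

section Evolution

variable {E : Type*} [NormedAddCommGroup E] [InnerProductSpace ℂ E] [FiniteDimensional ℂ E]

namespace IsEvolution

variable {G U : ℝ → E →L[ℂ] E} {s : ℝ}

theorem hasDerivWithinAt {F : Type*} [NormedAddCommGroup F] [InnerProductSpace ℂ F]
    {G U : ℝ → F →L[ℂ] F} (hU : IsEvolution G U) (hs : s ∈ Icc (0 : ℝ) 1) :
    HasDerivWithinAt U (-Complex.I • (G s * U s)) (Icc 0 1) s := by
  obtain ⟨U', hU', h⟩ := hU.2 s hs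
  rw [← h, smul_smul, neg_mul, Complex.I_mul_I, neg_neg, one_smul]
  exact hU'

theorem hasDerivWithinAt_star (hU : IsEvolution G U) (hG : IsSelfAdjoint (G s))
    (hs : s ∈ Icc (0 : ℝ) 1) :
    HasDerivWithinAt (fun t => star (U t)) (Complex.I • (star (U s) * G s)) (Icc 0 1) s := by
  have h := (hU.hasDerivWithinAt hs).star
  rwa [star_smul, star_mul, hG.star_eq, Complex.star_def, map_neg, Complex.conj_I, neg_neg] at h

theorem eq_of_deriv_eq_zero {F : Type*} [NormedAddCommGroup F] [NormedSpace ℝ F] {f : ℝ → F}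
    (hf : ∀ t ∈ Icc (0 : ℝ) 1, HasDerivWithinAt f 0 (Icc 0 1) t) (hs : s ∈ Icc (0 : ℝ) 1) :
    f s = f 0 :=
  constant_of_derivWithin_zero (fun t ht => (hf t ht).differentiableWithinAt)
    (fun t ht => (hf t (Ico_subset_Icc_self ht)).derivWithin
      (uniqueDiffOn_Icc zero_lt_one t (Ico_subset_Icc_self ht))) s hs

theorem star_mul_self (hU : IsEvolution G U) (hG : ∀ t ∈ Icc (0 : ℝ) 1, IsSelfAdjoint (G t))
    (hs : s ∈ Icc (0 : ℝ) 1) : star (U s) * U s = 1 := by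
  have h : ∀ t ∈ Icc (0 : ℝ) 1,
      HasDerivWithinAt (fun t => star (U t) * U t) 0 (Icc 0 1) t := by
    intro t ht
    have h1 := (hU.hasDerivWithinAt_star (hG t ht) ht).mul (hU.hasDerivWithinAt ht)
    have h2 : Complex.I • (star (U t) * G t) * U t + star (U t) * (-Complex.I • (G t * U t))
        = 0 := by
      rw [smul_mul_assoc, mul_smul_comm, mul_assoc, neg_smul, add_neg_cancel]
    rw [h2] at h1
    exact h1
  have h3 := eq_of_deriv_eq_zero h hs
  simpa [hU.1] using h3

theorem mul_star_self (hU : IsEvolution G U) (hG : ∀ t ∈ Icc (0 : ℝ) 1, IsSelfAdjoint (G t))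
    (hs : s ∈ Icc (0 : ℝ) 1) : U s * star (U s) = 1 := by
  have h := hU.star_mul_self hG hs
  have h0 : ((star (U s) : E →L[ℂ] E) : E →ₗ[ℂ] E) * (U s : E →ₗ[ℂ] E) = 1 :=
    congrArg ContinuousLinearMap.toLinearMap h
  have h1 := mul_eq_one_comm.mp h0
  ext v
  exact congrArg (fun f : E →ₗ[ℂ] E => f v) h1

theorem norm_le_one (hU : IsEvolution G U) (hG : ∀ t ∈ Icc (0 : ℝ) 1, IsSelfAdjoint (G t))
    (hs : s ∈ Icc (0 : ℝ) 1) : ‖U s‖ ≤ 1 := by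
  have h := congrArg norm (hU.star_mul_self hG hs)
  have h2 : ‖star (U s) * U s‖ = ‖U s‖ * ‖U s‖ := CStarRing.norm_star_mul_self
  rw [h2] at h
  have h1 : ‖(1 : E →L[ℂ] E)‖ ≤ 1 := ContinuousLinearMap.norm_id_le
  nlinarith [norm_nonneg (U s)]

end IsEvolution

theorem isSelfAdjoint_perturbedGenerator (S : Submodule ℂ E) {H Δ : ℝ → E →L[ℂ] E} (T : ℝ) {s : ℝ}
    (hH : IsSelfAdjoint (H s)) (hΔ : IsSelfAdjoint (Δ s)) :
    IsSelfAdjoint (perturbedGenerator S H Δ T s) := by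
  have hreal : ∀ (x : ℝ) {A : E →L[ℂ] E}, IsSelfAdjoint A → IsSelfAdjoint ((x : ℂ) • A) :=
    fun x A hA => by rw [isSelfAdjoint_iff, star_smul, hA.star_eq]; simp
  exact hreal _ ((hH.add (hreal _ (isSelfAdjoint_starProjection _))).add
    (isSelfAdjoint_perpPart S (H s) hΔ))

namespace IsGappedFamily

variable {S : Submodule ℂ E} {H Δ U V : ℝ → E →L[ℂ] E} {T s : ℝ}

theorem isSelfAdjoint_adiabaticGenerator (hS : IsGappedFamily S H) (hs : s ∈ Icc (0 : ℝ) 1) :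
    IsSelfAdjoint (adiabaticGenerator S H T s) := by
  have hp' : IsSelfAdjoint (dot (fun t => groundProj S (H t)) s) :=
    isSelfAdjoint_dot hs (hS.differentiableWithinAt_groundProj hs)
      fun t _ => isSelfAdjoint_groundProj S (H t)
  have hp := isSelfAdjoint_groundProj S (H s)
  rw [isSelfAdjoint_iff, adiabaticGenerator, star_add, star_smul, star_smul,
    (hS.isSelfAdjoint s hs).star_eq, star_sub, star_mul, star_mul, hp'.star_eq, hp.star_eq,
    Complex.star_def, Complex.conj_ofReal, Complex.conj_I, neg_smul, ← smul_neg, neg_sub]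

theorem mul_groundProj (hcomm : Commute (H s) S.starProjection) :
    H s * groundProj S (H s) = ((groundEnergy S (H s) : ℝ) : ℂ) • groundProj S (H s) := by
  have h1 := excitation_mul_groundProj S (H s)
  rw [excitation, sub_mul, sub_eq_zero, smul_mul_assoc, starProjection_mul_groundProj, block,
    ← hcomm.eq, mul_assoc, mul_assoc, starProjection_mul_groundProj,
    starProjection_mul_groundProj] at h1
  exact h1

theorem groundProj_mul (hsa : IsSelfAdjoint (H s)) (hcomm : Commute (H s) S.starProjection) :
    groundProj S (H s) * H s = ((groundEnergy S (H s) : ℝ) : ℂ) • groundProj S (H s) := by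
  have h := congrArg star (mul_groundProj hcomm)
  rwa [star_mul, star_smul, (isSelfAdjoint_groundProj S (H s)).star_eq, hsa.star_eq,
    Complex.star_def, Complex.conj_ofReal] at h

theorem shifted_mul_groundProj (hcomm : Commute (H s) S.starProjection) :
    shifted S (H s) * groundProj S (H s)
      = ((groundEnergy S (H s) : ℝ) : ℂ) • groundProj S (H s) := by
  have h : Sᗮ.starProjection * groundProj S (H s) = 0 :=
    mul_eq_zero_of_starProjection' (starProjection_mul_self Sᗮ)
      (starProjection_mul_groundProj S (H s))
  rw [shifted, add_mul, smul_mul_assoc, h, smul_zero, add_zero, mul_groundProj hcomm]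

theorem adiabaticGenerator_mul_groundProj (hS : IsGappedFamily S H) (hs : s ∈ Icc (0 : ℝ) 1)
    (hcomm : Commute (H s) S.starProjection) :
    adiabaticGenerator S H T s * groundProj S (H s)
      = ((T : ℂ) * ((groundEnergy S (H s) : ℝ) : ℂ)) • groundProj S (H s)
        + Complex.I • (dot (fun t => groundProj S (H t)) s * groundProj S (H s)) := by
  rw [adiabaticGenerator, add_mul, smul_mul_assoc, smul_mul_assoc, mul_groundProj hcomm, sub_mul,
    hS.groundProj_mul_dot_mul hs, sub_zero, mul_assoc, groundProj_mul_self, smul_smul]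

theorem groundProj_mul_adiabaticGenerator (hS : IsGappedFamily S H) (hs : s ∈ Icc (0 : ℝ) 1)
    (hcomm : Commute (H s) S.starProjection) :
    groundProj S (H s) * adiabaticGenerator S H T s
      = ((T : ℂ) * ((groundEnergy S (H s) : ℝ) : ℂ)) • groundProj S (H s)
        - Complex.I • (groundProj S (H s) * dot (fun t => groundProj S (H t)) s) := by
  rw [adiabaticGenerator, mul_add, mul_smul_comm, mul_smul_comm,
    groundProj_mul (hS.isSelfAdjoint s hs) hcomm, mul_sub, ← mul_assoc, ← mul_assoc,
    hS.groundProj_mul_dot_mul hs, zero_sub, groundProj_mul_self, smul_smul, smul_neg,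
    sub_eq_add_neg]

theorem perturbedGenerator_mul_groundProj (hcomm : Commute (H s) S.starProjection) :
    perturbedGenerator S H Δ T s * groundProj S (H s)
      = ((T : ℂ) * ((groundEnergy S (H s) : ℝ) : ℂ)) • groundProj S (H s) := by
  rw [perturbedGenerator, smul_mul_assoc, add_mul, shifted_mul_groundProj hcomm,
    perpPart_mul_groundProj, add_zero, smul_smul]

/-- The adiabatic evolution transports the ground space. -/
theorem adiabatic_intertwining (hS : IsGappedFamily S H)
    (hcomm : ∀ t ∈ Icc (0 : ℝ) 1, Commute (H t) S.starProjection)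
    (hV : IsEvolution (adiabaticGenerator S H T) V) (hs : s ∈ Icc (0 : ℝ) 1) :
    groundProj S (H s) * V s = V s * groundProj S (H 0) := by
  have hsa : ∀ t ∈ Icc (0 : ℝ) 1, IsSelfAdjoint (adiabaticGenerator S H T t) :=
    fun t ht => hS.isSelfAdjoint_adiabaticGenerator ht
  have h : ∀ t ∈ Icc (0 : ℝ) 1,
      HasDerivWithinAt (fun t => star (V t) * groundProj S (H t) * V t) 0 (Icc 0 1) t := by
    intro t ht
    have h1 := ((hV.hasDerivWithinAt_star (hsa t ht) ht).mul
      (hS.hasDerivWithinAt_groundProj ht)).mul (hV.hasDerivWithinAt ht)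
    have hKp := hS.adiabaticGenerator_mul_groundProj (T := T) ht (hcomm t ht)
    have hpK := hS.groundProj_mul_adiabaticGenerator (T := T) ht (hcomm t ht)
    -- The Heisenberg equation for `P`: the `T μ P` terms cancel, and the rest is `-(Ṗ P + P Ṗ) + Ṗ
    -- = 0`.
    have key : Complex.I • (adiabaticGenerator S H T t * groundProj S (H t))
        + dot (fun t => groundProj S (H t)) t
        - Complex.I • (groundProj S (H t) * adiabaticGenerator S H T t) = 0 := by
      rw [hKp, hpK, smul_add, smul_sub, smul_smul Complex.I Complex.I,
        smul_smul Complex.I Complex.I, Complex.I_mul_I, neg_one_smul, neg_one_smul]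
      nth_rewrite 2 [← hS.dot_groundProj_mul_add ht]
      abel
    have h2 : ∀ (W K p p' X : E →L[ℂ] E),
        (Complex.I • (W * K) * p + W * p') * X + W * p * (-Complex.I • (K * X))
          = W * (Complex.I • (K * p) + p' - Complex.I • (p * K)) * X := by
      intro W K p p' X
      simp only [smul_mul_assoc, mul_smul_comm, add_mul, mul_add, neg_smul, mul_assoc,
        sub_eq_add_neg, mul_neg, neg_mul]
    rw [Pi.mul_apply, h2, key, mul_zero, zero_mul] at h1
    exact h1
  have h3 := IsEvolution.eq_of_deriv_eq_zero h hs
  simp only [hV.1, star_one, one_mul, mul_one] at h3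
  rw [← h3, ← mul_assoc, ← mul_assoc, hV.mul_star_self hsa hs, one_mul]

/-- The comparison of the two evolutions, up to a boundary term of order `1 / T`. -/
theorem hasDerivWithinAt_comparison (hS : IsGappedFamily S H) (hS' : IsGappedFamily Sᗮ H)
    (hT : T ≠ 0) (hcomm : ∀ t ∈ Icc (0 : ℝ) 1, Commute (H t) S.starProjection)
    (hΔ_sa : ∀ t ∈ Icc (0 : ℝ) 1, IsSelfAdjoint (Δ t))
    (hΔ : DifferentiableOn ℝ Δ (Icc 0 1))
    (h2 : DifferentiableOn ℝ (dot fun t => block S (H t)) (Icc 0 1))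
    (hη : ∀ t ∈ Icc (0 : ℝ) 1, 0 < eta S (H t) (Δ t))
    (hU : IsEvolution (perturbedGenerator S H Δ T) U)
    (hV : IsEvolution (adiabaticGenerator S H T) V) (hs : s ∈ Icc (0 : ℝ) 1) :
    HasDerivWithinAt (fun t => star (U t) * (V t * groundProj S (H 0))
        - (Complex.I * T)⁻¹ • (star (U t) * correction S H Δ t * (V t * groundProj S (H 0))))
      (-(Complex.I * T : ℂ)⁻¹ • (star (U s) * (dot (correction S H Δ) s * groundProj S (H s))
        * (V s * groundProj S (H 0)))) (Icc 0 1) s := by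
  have hG := isSelfAdjoint_perturbedGenerator S T (hS.isSelfAdjoint s hs) (hΔ_sa s hs)
  have hGp := perturbedGenerator_mul_groundProj (Δ := Δ) (T := T) (hcomm s hs)
  have hKp := hS.adiabaticGenerator_mul_groundProj (T := T) hs (hcomm s hs)
  have hGY : perturbedGenerator S H Δ T s * correction S H Δ s
      = ((T : ℂ) * ((groundEnergy S (H s) : ℝ) : ℂ)) • correction S H Δ s
        + (T : ℂ) • (dot (fun t => groundProj S (H t)) s * groundProj S (H s)) := by
    rw [perturbedGenerator, smul_mul_assoc,
      hS.shifted_add_perpPart_mul_correction hS' hs (hη s hs) (hcomm s hs), smul_add, smul_smul]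
  have hYp := correction_mul_groundProj S H Δ s
  -- Because `Y = Y P` and `P Ṗ P = 0`, the commutator term of the adiabatic generator is invisible
  -- to `Y`.
  have hYp' : correction S H Δ s * (dot (fun t => groundProj S (H t)) s * groundProj S (H s))
      = 0 := by
    rw [← hYp, mul_assoc, ← mul_assoc (groundProj S (H s)), hS.groundProj_mul_dot_mul hs, mul_zero]
  have hX : groundProj S (H s) * (V s * groundProj S (H 0)) = V s * groundProj S (H 0) := by
    rw [← mul_assoc, hS.adiabatic_intertwining hcomm hV hs, mul_assoc, groundProj_mul_self]
  have hU' := hU.hasDerivWithinAt_star hG hs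
  have hV' := (hV.hasDerivWithinAt hs).mul_const (groundProj S (H 0))
  rw [smul_mul_assoc, mul_assoc (adiabaticGenerator S H T s)] at hV'
  have hY : HasDerivWithinAt (correction S H Δ) (dot (correction S H Δ) s) (Icc 0 1) s :=
    (hS.differentiableWithinAt_correction hS' hΔ h2 hs (hη s hs)).hasDerivWithinAt
  have hd := (hU'.mul hV').sub (((hU'.mul hY).mul hV').const_smul (Complex.I * T : ℂ)⁻¹)
  refine HasDerivWithinAt.congr_deriv hd ?_
  simp only [Pi.mul_apply]
  set G := perturbedGenerator S H Δ T s
  set K := adiabaticGenerator S H T s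
  set p := groundProj S (H s)
  set p' := dot (fun t => groundProj S (H t)) s
  set Y := correction S H Δ s
  set Y' := dot (correction S H Δ) s
  set X := V s * groundProj S (H 0)
  set W := star (U s)
  set μ : ℂ := ((groundEnergy S (H s) : ℝ) : ℂ)
  have hKX : K * X = (T * μ) • X + Complex.I • (p' * X) := by
    have h := congrArg (fun x => x * X) hKp
    simpa only [add_mul, smul_mul_assoc, mul_assoc, hX] using h
  have hGX : G * X = (T * μ) • X := by
    have h := congrArg (fun x => x * X) hGp
    simpa only [smul_mul_assoc, mul_assoc, hX] using h
  have hYpX : Y * (p' * X) = 0 := by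
    have h := congrArg (fun x => x * X) hYp'
    simpa only [mul_assoc, hX, zero_mul] using h
  have hGYX : G * (Y * X) = (T * μ) • (Y * X) + (T : ℂ) • (p' * X) := by
    have h := congrArg (fun x => x * X) hGY
    simpa only [add_mul, smul_mul_assoc, mul_assoc, hX] using h
  have hT' : (T : ℂ) ≠ 0 := by exact_mod_cast hT
  simp only [hKX, mul_add, add_mul, smul_mul_assoc, mul_smul_comm, mul_assoc, hGX, hGYX, hYpX, hX,
    smul_add, smul_smul, mul_zero, smul_zero, add_zero]
  have hI : Complex.I ≠ 0 := Complex.I_ne_zero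
  have e1 : -Complex.I * Complex.I = 1 := by rw [neg_mul, Complex.I_mul_I, neg_neg]
  have e2 : (Complex.I * T : ℂ)⁻¹ * (Complex.I * T) = 1 := inv_mul_cancel₀ (mul_ne_zero hI hT')
  rw [e1, e2]
  module

theorem norm_evolution_sub_mul_groundProj_le (hS : IsGappedFamily S H)
    (hS' : IsGappedFamily Sᗮ H) (hT : 0 < T)
    (hcomm : ∀ t ∈ Icc (0 : ℝ) 1, Commute (H t) S.starProjection)
    (hΔ_sa : ∀ t ∈ Icc (0 : ℝ) 1, IsSelfAdjoint (Δ t))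
    (hΔ : DifferentiableOn ℝ Δ (Icc 0 1))
    (h2 : DifferentiableOn ℝ (dot fun t => block S (H t)) (Icc 0 1))
    (hη : ∀ t ∈ Icc (0 : ℝ) 1, 0 < eta S (H t) (Δ t))
    (hU : IsEvolution (perturbedGenerator S H Δ T) U)
    (hV : IsEvolution (adiabaticGenerator S H T) V) {m₁ m₂ : ℝ}
    (hm₁ : ∀ t ∈ Icc (0 : ℝ) 1, 1 / (eta S (H t) (Δ t) * T) * boundaryConst S H t ≤ m₁)
    (hm₂ : ∀ t ∈ Icc (0 : ℝ) 1, 1 / (eta S (H t) (Δ t) * T) * bulkConst S H Δ t ≤ m₂) :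
    ‖(U 1 - V 1) * groundProj S (H 0)‖ ≤ m₁ + m₂ := by
  have hG : ∀ t ∈ Icc (0 : ℝ) 1, IsSelfAdjoint (perturbedGenerator S H Δ T t) := fun t ht =>
    isSelfAdjoint_perturbedGenerator S T (hS.isSelfAdjoint t ht) (hΔ_sa t ht)
  have hK : ∀ t ∈ Icc (0 : ℝ) 1, IsSelfAdjoint (adiabaticGenerator S H T t) := fun t ht =>
    hS.isSelfAdjoint_adiabaticGenerator ht
  have hW : ∀ t ∈ Icc (0 : ℝ) 1, ‖star (U t)‖ ≤ 1 := fun t ht =>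
    (norm_star (U t)).trans_le (hU.norm_le_one hG ht)
  have hX : ∀ t ∈ Icc (0 : ℝ) 1, ‖V t * groundProj S (H 0)‖ ≤ 1 := fun t ht =>
    (norm_mul_le _ _).trans (mul_le_one₀ (hV.norm_le_one hK ht) (norm_nonneg _)
      (norm_groundProj_le S (H 0)))
  have hc : ‖(Complex.I * T : ℂ)⁻¹‖ = 1 / T := by
    rw [norm_inv, norm_mul, Complex.norm_I, one_mul, Complex.norm_real, Real.norm_eq_abs,
      abs_of_pos hT, one_div]
  have h01 : (0 : ℝ) ∈ Icc (0 : ℝ) 1 := ⟨le_rfl, zero_le_one⟩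
  have h11 : (1 : ℝ) ∈ Icc (0 : ℝ) 1 := ⟨zero_le_one, le_rfl⟩
  have hsandwich : ∀ t ∈ Icc (0 : ℝ) 1, ∀ A : E →L[ℂ] E,
      ‖(Complex.I * T : ℂ)⁻¹ • (star (U t) * A * (V t * groundProj S (H 0)))‖ ≤ 1 / T * ‖A‖ := by
    intro t ht A
    rw [norm_smul, hc]
    gcongr
    calc _ ≤ ‖star (U t)‖ * ‖A‖ * ‖V t * groundProj S (H 0)‖ := norm_mul₃_le
      _ ≤ 1 * ‖A‖ * 1 := by
          gcongr
          · exact hW t ht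
          · exact hX t ht
      _ = ‖A‖ := by ring
  -- The mean value inequality needs only a pointwise derivative, so no integrability of `Ẏ` enters.
  have hbulk := norm_image_sub_le_of_norm_deriv_le_segment_01' (C := m₂)
    (fun t ht => hS.hasDerivWithinAt_comparison hS' hT.ne' hcomm hΔ_sa hΔ h2 hη hU hV ht) (by
      intro t ht
      have ht' := Ico_subset_Icc_self ht
      rw [neg_smul, norm_neg]
      refine (hsandwich t ht' _).trans (le_trans ?_ (hm₂ t ht'))
      have := hS.norm_dot_correction_mul_le hS' hΔ h2 ht' hη
      calc _ ≤ 1 / T * (1 / eta S (H t) (Δ t) * bulkConst S H Δ t) := by gcongr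
        _ = _ := by rw [← mul_assoc, one_div_mul_one_div_rev])
  -- Half of `m₁` per end point, as the 2 in `boundaryConst` counts both.
  have hbdry : ∀ t ∈ Icc (0 : ℝ) 1, ‖(Complex.I * T : ℂ)⁻¹ •
      (star (U t) * correction S H Δ t * (V t * groundProj S (H 0)))‖ ≤ m₁ / 2 := by
    intro t ht
    refine (hsandwich t ht _).trans ?_
    have h1 := hS.norm_correction_le hS' ht (hη t ht)
    have h3 := hm₁ t ht
    have h4 : 1 / T * ‖correction S H Δ t‖
        ≤ 1 / T * (1 / eta S (H t) (Δ t) * (normDot S H t / localGap S (H t) ^ 2)) := by gcongr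
    rw [← mul_assoc, one_div_mul_one_div_rev] at h4
    rw [boundaryConst] at h3
    linarith
  have hb0 := hbdry 0 h01
  have hb1 := hbdry 1 h11
  have hrot : ‖(U 1 - V 1) * groundProj S (H 0)‖
      ≤ ‖star (U 1) * (V 1 * groundProj S (H 0)) - groundProj S (H 0)‖ := by
    have h3 : (U 1 - V 1) * groundProj S (H 0)
        = -(U 1 * (star (U 1) * (V 1 * groundProj S (H 0)) - groundProj S (H 0))) := by
      rw [mul_sub, ← mul_assoc, hU.mul_star_self hG h11, one_mul, sub_mul]
      abel
    rw [h3, norm_neg]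
    exact (norm_mul_le _ _).trans
      (mul_le_of_le_one_left (norm_nonneg _) (hU.norm_le_one hG h11))
  refine hrot.trans ?_
  set F₁ := (Complex.I * T : ℂ)⁻¹ •
    (star (U 1) * correction S H Δ 1 * (V 1 * groundProj S (H 0)))
  set F₀ := (Complex.I * T : ℂ)⁻¹ •
    (star (U 0) * correction S H Δ 0 * (V 0 * groundProj S (H 0)))
  have hzero : star (U 0) * (V 0 * groundProj S (H 0)) = groundProj S (H 0) := by
    rw [hU.1, hV.1, star_one, one_mul, one_mul]
  rw [hzero] at hbulk
  have hsplit : star (U 1) * (V 1 * groundProj S (H 0)) - groundProj S (H 0)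
      = (star (U 1) * (V 1 * groundProj S (H 0)) - F₁ - (groundProj S (H 0) - F₀)) + (F₁ - F₀) := by
    abel
  rw [hsplit]
  refine (norm_add_le _ _).trans ?_
  linarith [norm_sub_le F₁ F₀]

end IsGappedFamily

theorem block_hasDerivWithinAt (S : Submodule ℂ E) {H : ℝ → E →L[ℂ] E} {H' : E →L[ℂ] E} {s : ℝ}
    (h : HasDerivWithinAt H H' (Icc 0 1) s) :
    HasDerivWithinAt (fun t => block S (H t)) (block S H') (Icc 0 1) s :=
  (h.const_mul S.starProjection).mul_const S.starProjection

theorem differentiableOn_dot_block (S : Submodule ℂ E) {H : ℝ → E →L[ℂ] E}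
    (h : DifferentiableOn ℝ H (Icc 0 1)) (h2 : DifferentiableOn ℝ (dot H) (Icc 0 1)) :
    DifferentiableOn ℝ (dot fun t => block S (H t)) (Icc 0 1) := by
  have heq : ∀ t ∈ Icc (0 : ℝ) 1, dot (fun t => block S (H t)) t = block S (dot H t) :=
    fun t ht => (block_hasDerivWithinAt S (h t ht).hasDerivWithinAt).derivWithin
      (uniqueDiffOn_Icc zero_lt_one t ht)
  exact fun t ht => ((block_hasDerivWithinAt S (h2 t ht).hasDerivWithinAt).congr heq
    (heq t ht)).differentiableWithinAt

end Evolution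

end LocalAdiabatic

/-! ### The theorem with extended-real suprema -/

theorem mainTheorem3 {E : Type*} [NormedAddCommGroup E] [InnerProductSpace ℂ E]
    [FiniteDimensional ℂ E] (S : Submodule ℂ E) (H Δ : ℝ → E →L[ℂ] E) (T : ℝ) (hT : 0 < T)
    -- `H` is a twice differentiable family of block-diagonal Hamiltonians
    (hH_sa : ∀ s ∈ Icc (0 : ℝ) 1, IsSelfAdjoint (H s))
    (hH_block : ∀ s ∈ Icc (0 : ℝ) 1, Commute (H s) S.starProjection)
    (hH_diff : DifferentiableOn ℝ H (Icc 0 1))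
    (hH_diff2 : DifferentiableOn ℝ (LocalAdiabatic.dot H) (Icc 0 1))
    -- `Δ` is a differentiable family of block-antidiagonal Hermitian perturbations
    (hΔ_sa : ∀ s ∈ Icc (0 : ℝ) 1, IsSelfAdjoint (Δ s))
    (hΔ_block : ∀ s ∈ Icc (0 : ℝ) 1, Δ s * S.starProjection = Sᗮ.starProjection * Δ s)
    (hΔ_diff : DifferentiableOn ℝ Δ (Icc 0 1))
    -- both blocks have at least two distinct eigenvalues, so that both local gaps are defined
    (hgap : ∀ s ∈ Icc (0 : ℝ) 1, (LocalAdiabatic.localSpectrum S (H s)).Nontrivial)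
    (hgap' : ∀ s ∈ Icc (0 : ℝ) 1, (LocalAdiabatic.localSpectrum Sᗮ (H s)).Nontrivial)
    -- the local ground energies have constant multiplicity (for example, they are simple)
    (hmult : ∀ s ∈ Icc (0 : ℝ) 1, Module.finrank ℂ (LocalAdiabatic.groundSpace S (H s)) =
      Module.finrank ℂ (LocalAdiabatic.groundSpace S (H 0)))
    (hmult' : ∀ s ∈ Icc (0 : ℝ) 1, Module.finrank ℂ (LocalAdiabatic.groundSpace Sᗮ (H s)) =
      Module.finrank ℂ (LocalAdiabatic.groundSpace Sᗮ (H 0)))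
    -- the perturbation is smaller than the local gaps
    (hη : ∀ s ∈ Icc (0 : ℝ) 1, 0 < LocalAdiabatic.eta S (H s) (Δ s))
    (U V : ℝ → E →L[ℂ] E)
    (hU : LocalAdiabatic.IsEvolution (LocalAdiabatic.perturbedGenerator S H Δ T) U)
    (hV : LocalAdiabatic.IsEvolution (LocalAdiabatic.adiabaticGenerator S H T) V) :
    ((‖(U 1 - V 1) * LocalAdiabatic.groundProj S (H 0)‖ : ℝ) : EReal) ≤
      (⨆ s : Icc (0 : ℝ) 1, ((1 / (LocalAdiabatic.eta S (H s) (Δ s) * T)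
          * LocalAdiabatic.boundaryConst S H s : ℝ) : EReal))
      + ⨆ s : Icc (0 : ℝ) 1, ((1 / (LocalAdiabatic.eta S (H s) (Δ s) * T)
          * LocalAdiabatic.bulkConst S H Δ s : ℝ) : EReal) := by
  have hblock : ∀ K : Submodule ℂ E,
      DifferentiableOn ℝ (fun t => LocalAdiabatic.block K (H t)) (Icc 0 1) := fun K t ht =>
    (LocalAdiabatic.block_hasDerivWithinAt K
      (hH_diff t ht).hasDerivWithinAt).differentiableWithinAt
  have hS : LocalAdiabatic.IsGappedFamily S H :=
    ⟨hH_sa, hblock S, hgap, fun s hs t ht => (hmult s hs).trans (hmult t ht).symm⟩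
  have hS' : LocalAdiabatic.IsGappedFamily Sᗮ H :=
    ⟨hH_sa, hblock Sᗮ, hgap', fun s hs t ht => (hmult' s hs).trans (hmult' t ht).symm⟩
  have h2 := LocalAdiabatic.differentiableOn_dot_block S hH_diff hH_diff2
  have hmain := fun m₁ m₂ => hS.norm_evolution_sub_mul_groundProj_le (m₁ := m₁) (m₂ := m₂) hS' hT
    hH_block hΔ_sa hΔ_diff h2 hη hU hV
  have hle₁ : ∀ t (ht : t ∈ Icc (0 : ℝ) 1), _ ≤ _ := fun t ht =>
    le_iSup (fun s : Icc (0 : ℝ) 1 => ((1 / (LocalAdiabatic.eta S (H s) (Δ s) * T)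
      * LocalAdiabatic.boundaryConst S H s : ℝ) : EReal)) ⟨t, ht⟩
  have hle₂ : ∀ t (ht : t ∈ Icc (0 : ℝ) 1), _ ≤ _ := fun t ht =>
    le_iSup (fun s : Icc (0 : ℝ) 1 => ((1 / (LocalAdiabatic.eta S (H s) (Δ s) * T)
      * LocalAdiabatic.bulkConst S H Δ s : ℝ) : EReal)) ⟨t, ht⟩
  have h01 : (0 : ℝ) ∈ Icc (0 : ℝ) 1 := ⟨le_rfl, zero_le_one⟩
  generalize (⨆ s : Icc (0 : ℝ) 1, ((1 / (LocalAdiabatic.eta S (H s) (Δ s) * T)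
    * LocalAdiabatic.boundaryConst S H s : ℝ) : EReal)) = M₁ at hle₁ ⊢
  generalize (⨆ s : Icc (0 : ℝ) 1, ((1 / (LocalAdiabatic.eta S (H s) (Δ s) * T)
    * LocalAdiabatic.bulkConst S H Δ s : ℝ) : EReal)) = M₂ at hle₂ ⊢
  -- In `EReal` one has `⊤ + ⊥ = ⊥`, so an infinite supremum makes the bound trivial only once the
  -- other is known not to be `⊥`; the value at `0` ensures this.
  have hb₁ : M₁ ≠ ⊥ := ((EReal.bot_lt_coe _).trans_le (hle₁ 0 h01)).ne'
  have hb₂ : M₂ ≠ ⊥ := ((EReal.bot_lt_coe _).trans_le (hle₂ 0 h01)).ne'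
  rcases eq_or_ne M₁ ⊤ with rfl | ht₁
  · rw [EReal.top_add_of_ne_bot hb₂]
    exact le_top
  rcases eq_or_ne M₂ ⊤ with rfl | ht₂
  · rw [EReal.add_top_of_ne_bot hb₁]
    exact le_top
  lift M₁ to ℝ using ⟨ht₁, hb₁⟩
  lift M₂ to ℝ using ⟨ht₂, hb₂⟩
  rw [← EReal.coe_add, EReal.coe_le_coe_iff]
  exact hmain M₁ M₂ (fun t ht => EReal.coe_le_coe_iff.mp (hle₁ t ht))
    fun t ht => EReal.coe_le_coe_iff.mp (hle₂ t ht)
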